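/- Let $n\ge 2$, $1\le p\le\infty$, $0<s<1$ with $sp\ge n$ (a condition that always holds if $p=\infty$), and $1\le r<q<\infty$. Let $K,V:\mathbb{R}^n\to(0,\infty)$ be Lebesgue measurable functions such that $\inf_{\mathbb{R}^n}V\ge V_0$ for some constant $V_0>0$ and $K\in L^t_{\mathrm{loc}}(\mathbb{R}^n)$ for some $t\in(1,\infty]$. Suppose that for some $\tilde q\in(q,\infty)$ and some $\tau\in\bigl(0,\frac{r}{q-r}\bigr]$ one has $$K^{\psi_{\tilde q}(\tau)}\,V^{-\tau}\in L^1(\mathbb{R}^n),\qquad \psi_{\tilde q}(\tau):=\frac{\tilde q+\tau(\tilde q-q)}{\tilde q-r}.$$ Let $M_V^{s;q,p}(\mathbb{R}^n)$ be the Banach space obtained as the completion of the set of those real-valued $u\in C^1_c(\mathbb{R}^n)$ for which the following norm is finite (all of $C^1_c(\mathbb{R}^n)$ if $V$ is locally integrable), with respect to that norm: $$\|u\|_{M_V^{s;q,p}}:=\Bigl(\int_{\mathbb{R}^n}|u|^qV\,dx\Bigr)^{1/q}+[u]_{s,p},\qquad [u]_{s,p}^p:=\iint_{\mathbb{R}^n\times\mathbb{R}^n}\frac{|u(x)-u(y)|^p}{|x-y|^{n+sp}}\,dx\,dy,$$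 with $[u]_{s,\infty}:=\operatorname{ess\,sup}_{x\ne y}|u(x)-u(y)|/|x-y|^s$ if $p=\infty$. Let $L^r(K;\mathbb{R}^n)$ be the space of (classes of) measurable functions with norm $\bigl(\int_{\mathbb{R}^n}|u|^rK\,dx\bigr)^{1/r}<\infty$. Then $M_V^{s;q,p}(\mathbb{R}^n)$ embeds compactly into $L^r(K;\mathbb{R}^n)$: the identity on the above functions $u\in C^1_c(\mathbb{R}^n)$ extends to an injective, bounded linear operator $M_V^{s;q,p}(\mathbb{R}^n)\to L^r(K;\mathbb{R}^n)$, and this operator is compact. -/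

import Mathlib

open MeasureTheory
open scoped ENNReal

noncomputable section

namespace WeightedFractionalSobolev

/-- The measure `W dx` on `ℝⁿ`, for a weight function `W : ℝⁿ → ℝ`. -/
def weighted {n : ℕ} (W : EuclideanSpace ℝ (Fin n) → ℝ) : Measure (EuclideanSpace ℝ (Fin n)) :=
  volume.withDensity fun x => ENNReal.ofReal (W x)

/-- The weighted difference quotient `(u(x) - u(y)) / |x - y| ^ (n/p + s)` on `ℝⁿ × ℝⁿ`.
Here `n/p = 0` if `p = ∞`. Its `L^p(ℝⁿ × ℝⁿ)` norm is the Gagliardo seminorm `[u]_{s,p}`: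
for `p < ∞`, the `p`-th power of this norm is `∬ |u(x) - u(y)|^p / |x - y|^(n + sp) dx dy`;
for `p = ∞`, the norm is `ess sup |u(x) - u(y)| / |x - y|^s`. -/
def diffQuot {n : ℕ} (s : ℝ) (p : ℝ≥0∞) (u : EuclideanSpace ℝ (Fin n) → ℝ) :
    EuclideanSpace ℝ (Fin n) × EuclideanSpace ℝ (Fin n) → ℝ :=
  fun z => (u z.1 - u z.2) / ‖z.1 - z.2‖ ^ ((n : ℝ) * (p⁻¹).toReal + s)

/-- The Gagliardo seminorm `[u]_{s,p}` over `ℝⁿ`, with values in `[0, ∞]`. -/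
def gagliardo {n : ℕ} (s : ℝ) (p : ℝ≥0∞) (u : EuclideanSpace ℝ (Fin n) → ℝ) : ℝ≥0∞ :=
  eLpNorm (diffQuot s p u) p volume

/-- The quantity `‖u‖_{L^q(V)} + [u]_{s,p}`, with values in `[0, ∞]`. -/
def eNormMV {n : ℕ} (s q : ℝ) (p : ℝ≥0∞) (V u : EuclideanSpace ℝ (Fin n) → ℝ) : ℝ≥0∞ :=
  eLpNorm u (ENNReal.ofReal q) (weighted V) + gagliardo s p u

instance fact_one_le_ofReal {q : ℝ} [h : Fact (1 ≤ q)] : Fact (1 ≤ ENNReal.ofReal q) :=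
  ⟨ENNReal.one_le_ofReal.2 h.out⟩

section Lemmas

variable {n : ℕ} (s : ℝ) {q : ℝ} {p : ℝ≥0∞} {V u v : EuclideanSpace ℝ (Fin n) → ℝ}

theorem diffQuot_add : diffQuot s p (u + v) = diffQuot s p u + diffQuot s p v := by
  funext z
  simp only [diffQuot, Pi.add_apply]
  ring

theorem diffQuot_smul (c : ℝ) : diffQuot s p (c • u) = c • diffQuot s p u := by
  funext z
  simp only [diffQuot, Pi.smul_apply, smul_eq_mul]
  ring

theorem aestronglyMeasurable_diffQuot (hu : Continuous u) :
    AEStronglyMeasurable (diffQuot s p u) volume := by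
  refine Measurable.aestronglyMeasurable ?_
  have h := hu.measurable
  unfold diffQuot
  fun_prop

theorem eNormMV_zero : eNormMV s q p V 0 = 0 := by
  have h : diffQuot s p (0 : EuclideanSpace ℝ (Fin n) → ℝ) = 0 := by
    funext z
    simp [diffQuot]
  simp [eNormMV, gagliardo, h]

theorem eNormMV_add_le (hp : 1 ≤ p) (hq : 1 ≤ q) (hu : Continuous u) (hv : Continuous v) :
    eNormMV s q p V (u + v) ≤ eNormMV s q p V u + eNormMV s q p V v := by
  have h1 := eLpNorm_add_le (μ := weighted V) hu.aestronglyMeasurable hv.aestronglyMeasurable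
    (ENNReal.one_le_ofReal.2 hq)
  have h2 := eLpNorm_add_le (aestronglyMeasurable_diffQuot s (p := p) hu)
    (aestronglyMeasurable_diffQuot s (p := p) hv) hp
  rw [← diffQuot_add] at h2
  refine (add_le_add h1 h2).trans (le_of_eq ?_)
  simp only [eNormMV, gagliardo]
  ring

theorem eNormMV_smul (c : ℝ) : eNormMV s q p V (c • u) = ‖c‖ₑ * eNormMV s q p V u := by
  simp only [eNormMV, gagliardo, diffQuot_smul, eLpNorm_const_smul, mul_add]

end Lemmas

/-- The vector space of all `u ∈ C¹_c(ℝⁿ)` of finite norm `‖u‖_{L^q(V)} + [u]_{s,p}`. (If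
`0 < s < 1` and `V` is locally integrable, then this is all of `C¹_c(ℝⁿ)`.) -/
def testSubmodule (n : ℕ) (s q : ℝ) (p : ℝ≥0∞) (V : EuclideanSpace ℝ (Fin n) → ℝ)
    [hq : Fact (1 ≤ q)] [hp : Fact (1 ≤ p)] : Submodule ℝ (EuclideanSpace ℝ (Fin n) → ℝ) where
  carrier := {u | ContDiff ℝ 1 u ∧ HasCompactSupport u ∧ eNormMV s q p V u < ∞}
  zero_mem' := ⟨contDiff_const, HasCompactSupport.zero, by
    rw [eNormMV_zero]
    exact ENNReal.zero_lt_top⟩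
  add_mem' := fun {u v} hu hv => ⟨hu.1.add hv.1, hu.2.1.add hv.2.1,
    (eNormMV_add_le s hp.out hq.out hu.1.continuous hv.1.continuous).trans_lt
      (ENNReal.add_lt_top.2 ⟨hu.2.2, hv.2.2⟩)⟩
  smul_mem' := fun c u hu => ⟨hu.1.const_smul c, hu.2.1.smul_left (f := fun _ => c), by
    rw [eNormMV_smul]
    exact ENNReal.mul_lt_top enorm_lt_top hu.2.2⟩

/-- The space of test functions as a type of its own, to be equipped with the norm
`‖u‖_{L^q(V)} + [u]_{s,p}` (and not with the topology of pointwise convergence). -/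
def TestSpace (n : ℕ) (s q : ℝ) (p : ℝ≥0∞) (V : EuclideanSpace ℝ (Fin n) → ℝ)
    [Fact (1 ≤ q)] [Fact (1 ≤ p)] : Type :=
  testSubmodule n s q p V

section Instances

variable {n : ℕ} {s q : ℝ} {p : ℝ≥0∞} {V : EuclideanSpace ℝ (Fin n) → ℝ}
  [hq : Fact (1 ≤ q)] [hp : Fact (1 ≤ p)]

instance : AddCommGroup (TestSpace n s q p V) :=
  inferInstanceAs (AddCommGroup (testSubmodule n s q p V))

instance : Module ℝ (TestSpace n s q p V) :=
  inferInstanceAs (Module ℝ (testSubmodule n s q p V))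

/-- The function underlying a test function. -/
def TestSpace.toFun (u : TestSpace n s q p V) : EuclideanSpace ℝ (Fin n) → ℝ := u.1

instance : Norm (TestSpace n s q p V) := ⟨fun u => (eNormMV s q p V u.toFun).toReal⟩

theorem TestSpace.norm_smul_eq (c : ℝ) (u : TestSpace n s q p V) : ‖c • u‖ = ‖c‖ * ‖u‖ := by
  have h : (c • u).toFun = c • u.toFun := rfl
  change (eNormMV s q p V (c • u).toFun).toReal = ‖c‖ * (eNormMV s q p V u.toFun).toReal
  rw [h, eNormMV_smul, ENNReal.toReal_mul, toReal_enorm]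

theorem TestSpace.norm_triangle (u v : TestSpace n s q p V) : ‖u + v‖ ≤ ‖u‖ + ‖v‖ := by
  change (eNormMV s q p V (u.toFun + v.toFun)).toReal ≤
    (eNormMV s q p V u.toFun).toReal + (eNormMV s q p V v.toFun).toReal
  have hu : eNormMV s q p V u.toFun < ∞ := u.2.2.2
  have hv : eNormMV s q p V v.toFun < ∞ := v.2.2.2
  rw [← ENNReal.toReal_add hu.ne hv.ne]
  exact ENNReal.toReal_mono (ENNReal.add_lt_top.2 ⟨hu, hv⟩).ne
    (eNormMV_add_le s hp.out hq.out u.2.1.continuous v.2.1.continuous)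

theorem TestSpace.core : SeminormedSpace.Core ℝ (TestSpace n s q p V) where
  norm_nonneg _ := ENNReal.toReal_nonneg
  norm_smul := TestSpace.norm_smul_eq
  norm_triangle := TestSpace.norm_triangle

/-- `‖u‖_{L^q(V)} + [u]_{s,p}` is a seminorm, and a norm if `V` is positive. -/
instance : SeminormedAddCommGroup (TestSpace n s q p V) :=
  SeminormedAddCommGroup.ofCore TestSpace.core

instance : NormedSpace ℝ (TestSpace n s q p V) := { norm_smul_le := fun c u => (TestSpace.norm_smul_eq c u).le }

end Instances

/-- The Banach space `M_V^{s;q,p}(ℝⁿ)`: the completion of the space of test functions with respect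
to the norm `‖u‖_{L^q(V)} + [u]_{s,p}`. -/
abbrev MV (n : ℕ) (s q : ℝ) (p : ℝ≥0∞) (V : EuclideanSpace ℝ (Fin n) → ℝ)
    [Fact (1 ≤ q)] [Fact (1 ≤ p)] : Type :=
  UniformSpace.Completion (TestSpace n s q p V)

/-- The Banach space `L^r(K; ℝⁿ)`, with norm `(∫ |u|^r K dx)^(1/r)`. -/
abbrev LrK {n : ℕ} (r : ℝ) (K : EuclideanSpace ℝ (Fin n) → ℝ) : Type :=
  Lp ℝ (ENNReal.ofReal r) (weighted K)

end WeightedFractionalSobolev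

end

/-! ### Approximation by averages over balls -/

namespace WeightedFractionalSobolev

open ProbabilityTheory Metric

section Averages

variable {n : ℕ}

/-! Everything rests on averages at a scale h. By Jensen, replacing u near x by its mean over a ball
of radius h costs at most C h^s [u]_{s,p} in L^p (`eLpNorm_sub_stepAvg_le`). Let ‖u‖_q ≤ 1 and p <
∞. If h is chosen so that the ball has volume l^(-q), the averages stay below l, so {|u| > 2l} is
controlled by Chebyshev in L^p, and sp ≥ n makes its measure O(l^(-1-q)). For p = ∞, u is simply
bounded. The layer cake formula then gives L^m for m < q + 1, and iteration gives every finite m ≥ q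
(`exists_eLpNorm_le`), in particular m = q'.

Hölder with the factors |u|^q V, |u|^q' and K^ψ V^(-τ) bounds the L^r(K) norm over any set A by a
power of ∫_A K^ψ V^(-τ) (`exists_eLpNorm_weighted_restrict_le`). Hence unit-ball functions are
uniformly small in L^r(K) far out and on sets of small volume. On the rest of a large ball they are
close to their averages, and finitely many averages suffice (`exists_eLpNorm_sub_le_of_ballAvg`).
These averages are bounded numbers, so the image of the unit ball is totally bounded.

Injectivity on the completion is not automatic. It follows from Fatou: both parts of the norm are
lower semicontinuous under a.e. convergence (`injective_of_coe_eq`). -/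

theorem isProbabilityMeasure_cond_ball (c : EuclideanSpace ℝ (Fin n)) {h : ℝ} (hh : 0 < h) :
    IsProbabilityMeasure (volume[|ball c h]) :=
  cond_isProbabilityMeasure_of_finite (measure_ball_pos volume c hh).ne' measure_ball_lt_top.ne

/-- The exponent `(p⁻¹).toReal` is 0 at `p = ∞`, where normalising the measure costs nothing; one
formula thus serves all p. -/
theorem eLpNorm_cond_le {α F : Type*} [MeasurableSpace α] [NormedAddCommGroup F] (μ : Measure α)
    (B : Set α) (f : α → F) (p : ℝ≥0∞) :
    eLpNorm f p (μ[|B]) ≤ (μ B)⁻¹ ^ (p⁻¹).toReal * eLpNorm f p μ := by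
  rcases eq_or_ne p ∞ with rfl | hp
  · simp only [ENNReal.inv_top, ENNReal.toReal_zero, ENNReal.rpow_zero, one_mul,
      eLpNorm_exponent_top]
    exact eLpNormEssSup_mono_measure f (cond_absolutelyContinuous)
  · rw [ProbabilityTheory.cond, eLpNorm_smul_measure_of_ne_top hp, one_div, smul_eq_mul]
    gcongr
    exact Measure.restrict_le_self

/-- The average of `u` over the ball `B(c, h)`. -/
noncomputable def ballAvg (u : EuclideanSpace ℝ (Fin n) → ℝ) (c : EuclideanSpace ℝ (Fin n))
    (h : ℝ) : ℝ :=
  ∫ y, u y ∂(volume[|ball c h])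

theorem integrable_cond_ball {u : EuclideanSpace ℝ (Fin n) → ℝ} (hu : Continuous u)
    (c : EuclideanSpace ℝ (Fin n)) {h : ℝ} (hh : 0 < h) : Integrable u (volume[|ball c h]) := by
  rw [ProbabilityTheory.cond]
  refine Integrable.smul_measure ?_ (ENNReal.inv_ne_top.2 (measure_ball_pos volume c hh).ne')
  exact (hu.locallyIntegrable.integrableOn_isCompact (isCompact_closedBall c h)).mono_set
    ball_subset_closedBall

theorem enorm_ballAvg_le {u : EuclideanSpace ℝ (Fin n) → ℝ} (hu : Continuous u)
    (c : EuclideanSpace ℝ (Fin n)) {h : ℝ} (hh : 0 < h) {p : ℝ≥0∞} (hp : 1 ≤ p) :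
    ‖ballAvg u c h‖ₑ ≤ (volume (ball c h))⁻¹ ^ (p⁻¹).toReal * eLpNorm u p volume := by
  have := isProbabilityMeasure_cond_ball c hh
  calc ‖ballAvg u c h‖ₑ ≤ ∫⁻ y, ‖u y‖ₑ ∂(volume[|ball c h]) := enorm_integral_le_lintegral_enorm _
    _ = eLpNorm u 1 (volume[|ball c h]) := eLpNorm_one_eq_lintegral_enorm.symm
    _ ≤ eLpNorm u p (volume[|ball c h]) :=
      eLpNorm_le_eLpNorm_of_exponent_le hp hu.aestronglyMeasurable
    _ ≤ _ := eLpNorm_cond_le _ _ _ _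

/-- Jensen for the uniform probability on the ball. Both x and y lie within h of c, so |x - y| ≤ 2h
bounds the denominator of the difference quotient. -/
theorem enorm_sub_ballAvg_le (s : ℝ) (hs : 0 ≤ s) {u : EuclideanSpace ℝ (Fin n) → ℝ}
    (hu : Continuous u) {x c : EuclideanSpace ℝ (Fin n)} {h : ℝ} (hh : 0 < h) (hx : dist x c < h)
    {p : ℝ≥0∞} (hp : 1 ≤ p) :
    ‖u x - ballAvg u c h‖ₑ ≤ ENNReal.ofReal ((2 * h) ^ ((n : ℝ) * (p⁻¹).toReal + s)) *
      ((volume (ball c h))⁻¹ ^ (p⁻¹).toReal *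
        eLpNorm (fun y => diffQuot s p u (x, y)) p volume) := by
  have := isProbabilityMeasure_cond_ball c hh
  have h0 : u x - ballAvg u c h = ∫ y, (u x - u y) ∂(volume[|ball c h]) := by
    rw [integral_sub (integrable_const _) (integrable_cond_ball hu c hh)]
    simp [ballAvg]
  have hσ : 0 ≤ (n : ℝ) * (p⁻¹).toReal + s := by positivity
  calc ‖u x - ballAvg u c h‖ₑ ≤ ∫⁻ y, ‖u x - u y‖ₑ ∂(volume[|ball c h]) := by
        rw [h0]; exact enorm_integral_le_lintegral_enorm _
    _ = eLpNorm (fun y => u x - u y) 1 (volume[|ball c h]) := eLpNorm_one_eq_lintegral_enorm.symm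
    _ ≤ eLpNorm (fun y => u x - u y) p (volume[|ball c h]) :=
      eLpNorm_le_eLpNorm_of_exponent_le hp (by fun_prop)
    _ ≤ ENNReal.ofReal ((2 * h) ^ ((n : ℝ) * (p⁻¹).toReal + s)) *
        eLpNorm (fun y => diffQuot s p u (x, y)) p (volume[|ball c h]) := by
      refine eLpNorm_le_mul_eLpNorm_of_ae_le_mul ?_ p
      filter_upwards [ae_cond_mem measurableSet_ball] with y hy
      rcases eq_or_ne x y with rfl | hxy
      · simp only [sub_self, norm_zero]; positivity
      · have h1 : 0 < ‖x - y‖ := norm_pos_iff.2 (sub_ne_zero.2 hxy)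
        have h2 : ‖x - y‖ ≤ 2 * h := by
          rw [← dist_eq_norm]
          have h3 := dist_triangle_right x y c
          have h4 : dist y c < h := hy
          linarith
        have h3 : 0 < ‖x - y‖ ^ ((n : ℝ) * (p⁻¹).toReal + s) := Real.rpow_pos_of_pos h1 _
        rw [diffQuot, norm_div, Real.norm_of_nonneg h3.le, ← mul_div_assoc, le_div_iff₀ h3,
          mul_comm]
        gcongr
    _ ≤ _ := by
      gcongr
      exact eLpNorm_cond_le _ _ _ _

/-- Tonelli for finite p; for `p = ∞`, an a.e. bound on the product holds on almost every slice. -/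
theorem eLpNorm_eLpNorm_le {α β : Type*} [MeasurableSpace α] [MeasurableSpace β] (μ : Measure α)
    (ν : Measure β) [SFinite μ] [SFinite ν] {f : α × β → ℝ} (hf : Measurable f) {p : ℝ≥0∞}
    (hp : p ≠ 0) :
    eLpNorm (fun x => eLpNorm (fun y => f (x, y)) p ν) p μ ≤ eLpNorm f p (μ.prod ν) := by
  rcases eq_or_ne p ∞ with rfl | hp'
  · simp only [eLpNorm_exponent_top]
    refine eLpNormEssSup_le_of_ae_enorm_bound ?_
    filter_upwards [Measure.ae_ae_of_ae_prod (enorm_ae_le_eLpNormEssSup f (μ.prod ν))] with x hx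
    exact eLpNormEssSup_le_of_ae_enorm_bound hx
  · have hp0 := (ENNReal.toReal_pos hp hp').ne'
    simp only [eLpNorm_eq_lintegral_rpow_enorm_toReal hp hp', enorm_eq_self]
    rw [lintegral_prod _ (by fun_prop)]
    simp only [← ENNReal.rpow_mul, one_div, inv_mul_cancel₀ hp0, ENNReal.rpow_one]
    rfl

/-- A measurable choice, for each point `x`, of a member at distance `< h` in a countable dense
set. -/
theorem exists_measurable_index (n : ℕ) {h : ℝ} (hh : 0 < h) :
    ∃ N : EuclideanSpace ℝ (Fin n) → ℕ, Measurable N ∧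
      ∀ x, dist x (TopologicalSpace.denseSeq _ (N x)) < h := by
  classical
  have h1 : ∀ x : EuclideanSpace ℝ (Fin n), ∃ k, dist x (TopologicalSpace.denseSeq _ k) < h :=
    fun x => (TopologicalSpace.denseRange_denseSeq _).exists_dist_lt x hh
  refine ⟨fun x => Nat.find (h1 x), measurable_find h1 fun k => ?_, fun x => Nat.find_spec (h1 x)⟩
  exact measurableSet_ball

/-- The index, in a countable dense set, of a point at distance `< h` to `x`. -/
noncomputable def nearIndex {h : ℝ} (hh : 0 < h) : EuclideanSpace ℝ (Fin n) → ℕ :=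
  (exists_measurable_index n hh).choose

theorem measurable_nearIndex {h : ℝ} (hh : 0 < h) : Measurable (nearIndex (n := n) hh) :=
  (exists_measurable_index n hh).choose_spec.1

theorem dist_nearIndex_lt {h : ℝ} (hh : 0 < h) (x : EuclideanSpace ℝ (Fin n)) :
    dist x (TopologicalSpace.denseSeq _ (nearIndex hh x)) < h :=
  (exists_measurable_index n hh).choose_spec.2 x

/-- An approximation of `u` that takes countably many values, each of them an average of `u` over
a ball of radius `h` near the point in question. -/
noncomputable def stepAvg {h : ℝ} (hh : 0 < h) (u : EuclideanSpace ℝ (Fin n) → ℝ)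
    (x : EuclideanSpace ℝ (Fin n)) : ℝ :=
  ballAvg u (TopologicalSpace.denseSeq _ (nearIndex hh x)) h

/-- Taking centres from a countable set makes this a function of a measurable index in ℕ, so no
regularity of the averages in c is needed. -/
theorem measurable_stepAvg {h : ℝ} (hh : 0 < h) (u : EuclideanSpace ℝ (Fin n) → ℝ) :
    Measurable (stepAvg hh u) :=
  (measurable_of_countable
    fun k => ballAvg u (TopologicalSpace.denseSeq (EuclideanSpace ℝ (Fin n)) k) h).comp
    (measurable_nearIndex hh)

theorem volume_ball_eq (c : EuclideanSpace ℝ (Fin n)) {h : ℝ} (hh : 0 < h) :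
    volume (ball c h) =
      ENNReal.ofReal (h ^ n) * volume (ball (0 : EuclideanSpace ℝ (Fin n)) 1) := by
  simpa using Measure.addHaar_ball_of_pos volume c hh

/-- The measure of the unit ball, as a real number. -/
noncomputable def unitBallVolume (n : ℕ) : ℝ :=
  (volume (ball (0 : EuclideanSpace ℝ (Fin n)) 1)).toReal

theorem unitBallVolume_pos (n : ℕ) : 0 < unitBallVolume n :=
  ENNReal.toReal_pos (measure_ball_pos volume _ one_pos).ne' measure_ball_lt_top.ne

theorem volume_ball_eq_ofReal (c : EuclideanSpace ℝ (Fin n)) {h : ℝ} (hh : 0 < h) :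
    volume (ball c h) = ENNReal.ofReal (h ^ n * unitBallVolume n) := by
  rw [volume_ball_eq c hh, ENNReal.ofReal_mul (by positivity), unitBallVolume,
    ENNReal.ofReal_toReal measure_ball_lt_top.ne]

theorem inv_volume_ball_rpow (c : EuclideanSpace ℝ (Fin n)) {h : ℝ} (hh : 0 < h) {a : ℝ}
    (ha : 0 ≤ a) :
    (volume (ball c h))⁻¹ ^ a = ENNReal.ofReal ((h ^ n * unitBallVolume n) ^ (-a)) := by
  have := unitBallVolume_pos n
  rw [volume_ball_eq_ofReal c hh, ← ENNReal.ofReal_inv_of_pos (by positivity),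
    ENNReal.ofReal_rpow_of_nonneg (by positivity) ha, Real.rpow_neg (by positivity),
    Real.inv_rpow (by positivity)]

theorem enorm_stepAvg_le {u : EuclideanSpace ℝ (Fin n) → ℝ} (hu : Continuous u)
    {h : ℝ} (hh : 0 < h) {p : ℝ≥0∞} (hp : 1 ≤ p) (x : EuclideanSpace ℝ (Fin n)) :
    ‖stepAvg hh u x‖ₑ ≤ ENNReal.ofReal ((h ^ n * unitBallVolume n) ^ (-(p⁻¹).toReal)) *
      eLpNorm u p volume := by
  rw [← inv_volume_ball_rpow (TopologicalSpace.denseSeq _ (nearIndex hh x)) hh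
    ENNReal.toReal_nonneg]
  exact enorm_ballAvg_le hu _ hh hp

/-- Functions with finite Gagliardo seminorm are approximated in `L^p` by their averages. -/
theorem eLpNorm_sub_stepAvg_le (s : ℝ) (hs : 0 ≤ s) {u : EuclideanSpace ℝ (Fin n) → ℝ}
    (hu : Continuous u) {h : ℝ} (hh : 0 < h) {p : ℝ≥0∞} (hp : 1 ≤ p) :
    eLpNorm (u - stepAvg hh u) p volume ≤
      ENNReal.ofReal (2 ^ ((n : ℝ) * (p⁻¹).toReal + s) * unitBallVolume n ^ (-(p⁻¹).toReal) *
        h ^ s) * gagliardo s p u := by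
  have hω := unitBallVolume_pos n
  -- The powers h^(n/p) cancel against the volume of the ball and leave h^s.
  have hσ : ENNReal.ofReal (2 ^ ((n : ℝ) * (p⁻¹).toReal + s) *
      unitBallVolume n ^ (-(p⁻¹).toReal) * h ^ s) =
      ENNReal.ofReal ((2 * h) ^ ((n : ℝ) * (p⁻¹).toReal + s)) *
        ENNReal.ofReal ((h ^ n * unitBallVolume n) ^ (-(p⁻¹).toReal)) := by
    rw [← ENNReal.ofReal_mul (by positivity)]
    congr 1
    rw [Real.mul_rpow (by positivity) hh.le, Real.mul_rpow (by positivity) hω.le,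
      ← Real.rpow_natCast, ← Real.rpow_mul hh.le, Real.rpow_add hh, mul_neg, Real.rpow_neg hh.le]
    field_simp
  have hm : Measurable (diffQuot s p u) := by
    have := hu.measurable
    unfold diffQuot
    fun_prop
  rw [hσ]
  set A := ENNReal.ofReal ((2 * h) ^ ((n : ℝ) * (p⁻¹).toReal + s)) *
        ENNReal.ofReal ((h ^ n * unitBallVolume n) ^ (-(p⁻¹).toReal)) with hA
  have hA' : A ≠ ∞ := by simp [hA, ENNReal.mul_eq_top]
  calc eLpNorm (u - stepAvg hh u) p volume
      ≤ A * eLpNorm (fun x => eLpNorm (fun y => diffQuot s p u (x, y)) p volume) p volume := by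
        have h1 : ∀ x, ‖(u - stepAvg hh u) x‖ₑ ≤
            A.toNNReal * ‖eLpNorm (fun y => diffQuot s p u (x, y)) p volume‖ₑ := fun x => by
          rw [enorm_eq_self, ENNReal.coe_toNNReal hA', hA,
            ← inv_volume_ball_rpow (TopologicalSpace.denseSeq _ (nearIndex hh x)) hh
            ENNReal.toReal_nonneg, mul_assoc]
          exact enorm_sub_ballAvg_le s hs hu hh (dist_nearIndex_lt hh x) hp
        have h2 := eLpNorm_le_mul_eLpNorm_of_ae_le_mul' (ae_of_all volume h1) p
        rwa [ENNReal.coe_toNNReal hA'] at h2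
    _ ≤ A * gagliardo s p u := by
        gcongr
        exact eLpNorm_eLpNorm_le _ _ hm (zero_lt_one.trans_le hp).ne'

end Averages

end WeightedFractionalSobolev

/-! ### Unweighted embedding into L^m for q ≤ m < ∞ -/

namespace WeightedFractionalSobolev

open Metric

section Embedding

variable {n : ℕ}

theorem lintegral_ofReal_abs_rpow {α : Type*} [MeasurableSpace α] (μ : Measure α) (f : α → ℝ)
    {q : ℝ} (hq : 0 < q) :
    ∫⁻ x, ENNReal.ofReal (|f x| ^ q) ∂μ = eLpNorm f (ENNReal.ofReal q) μ ^ q := by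
  rw [eLpNorm_eq_lintegral_rpow_enorm_toReal (by simpa using hq) ENNReal.ofReal_ne_top,
    ENNReal.toReal_ofReal hq.le, ← ENNReal.rpow_mul, one_div, inv_mul_cancel₀ hq.ne',
    ENNReal.rpow_one]
  simp only [Real.enorm_eq_ofReal_abs, ENNReal.ofReal_rpow_of_nonneg (abs_nonneg _) hq.le]

/-- Chebyshev's inequality, with real constants. -/
theorem measure_le_abs_le {α : Type*} [MeasurableSpace α] (μ : Measure α) {f : α → ℝ}
    (hf : AEStronglyMeasurable f μ) {p : ℝ≥0∞} (hp : 1 ≤ p) (hp' : p ≠ ∞) {l A : ℝ} (hl : 0 < l)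
    (hA : 0 ≤ A) (h : eLpNorm f p μ ≤ ENNReal.ofReal A) :
    μ {x | l ≤ |f x|} ≤ ENNReal.ofReal (l ^ (-p.toReal) * A ^ p.toReal) := by
  have hp0 : 0 < p.toReal := ENNReal.toReal_pos (zero_lt_one.trans_le hp).ne' hp'
  have h1 := mul_meas_ge_le_pow_eLpNorm' μ (zero_lt_one.trans_le hp).ne' hp' hf (ENNReal.ofReal l)
  have h2 : {x | ENNReal.ofReal l ≤ ‖f x‖ₑ} = {x | l ≤ |f x|} := by
    ext x
    simp [Real.enorm_eq_ofReal_abs]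
  have h3 : eLpNorm f p μ ^ p.toReal ≤ ENNReal.ofReal (A ^ p.toReal) := by
    rw [← ENNReal.ofReal_rpow_of_nonneg hA hp0.le]
    gcongr
  rw [h2, ENNReal.ofReal_rpow_of_nonneg hl.le hp0.le] at h1
  rw [Real.rpow_neg hl.le, ENNReal.ofReal_mul (by positivity),
    ENNReal.ofReal_inv_of_pos (by positivity), mul_comm, ← div_eq_mul_inv,
    ENNReal.le_div_iff_mul_le (Or.inl (by simp; positivity)) (Or.inl ENNReal.ofReal_ne_top),
    mul_comm]
  exact h1.trans h3

theorem abs_stepAvg_le {u : EuclideanSpace ℝ (Fin n) → ℝ} (hu : Continuous u) {h : ℝ} (hh : 0 < h)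
    {q : ℝ} (hq : 1 ≤ q) (h1 : eLpNorm u (ENNReal.ofReal q) volume ≤ 1)
    (x : EuclideanSpace ℝ (Fin n)) :
    |stepAvg hh u x| ≤ (h ^ n * unitBallVolume n) ^ (-q⁻¹) := by
  have hω := unitBallVolume_pos n
  have h2 := (enorm_stepAvg_le hu hh (ENNReal.one_le_ofReal.2 hq) x).trans
    (mul_le_of_le_one_right' h1)
  rwa [Real.enorm_eq_ofReal_abs, ENNReal.ofReal_le_ofReal_iff (by positivity), ENNReal.toReal_inv,
    ENNReal.toReal_ofReal (by positivity)] at h2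

/-- A weak-type estimate that improves the trivial decay `l ^ (-q)` of the distribution function
of a function in `L^q` by one power of `l`. -/
theorem exists_measure_abs_gt_le_of_ne_top (hn : n ≠ 0) {s : ℝ} (hs : 0 < s) {p : ℝ≥0∞}
    (hp : 1 ≤ p) (hp' : p ≠ ∞) (hsp : (n : ℝ≥0∞) ≤ ENNReal.ofReal s * p) {q : ℝ} (hq : 1 ≤ q) :
    ∃ C : ℝ, 0 ≤ C ∧ ∀ u : EuclideanSpace ℝ (Fin n) → ℝ, Continuous u →
      eLpNorm u (ENNReal.ofReal q) volume ≤ 1 → gagliardo s p u ≤ 1 → ∀ l : ℝ, 1 ≤ l →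
        volume {x | 2 * l < |u x|} ≤ ENNReal.ofReal (C * l ^ (-(1 + q))) := by
  have hω := unitBallVolume_pos n
  have hn0 : (0 : ℝ) < n := by positivity
  have hP : 1 ≤ p.toReal := by
    simpa using ENNReal.toReal_mono hp' hp
  have hsP : (n : ℝ) ≤ s * p.toReal := by
    have := ENNReal.toReal_mono (ENNReal.mul_ne_top ENNReal.ofReal_ne_top hp') hsp
    simpa [ENNReal.toReal_mul, ENNReal.toReal_ofReal hs.le] using this
  set P := p.toReal
  set C₀ : ℝ := 2 ^ ((n : ℝ) * (p⁻¹).toReal + s) * unitBallVolume n ^ (-(p⁻¹).toReal) with hC₀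
  have hC₀0 : 0 ≤ C₀ := by positivity
  refine ⟨C₀ ^ P * unitBallVolume n ^ (-(s * P / n)), by positivity, fun u hu h1 h2 l hl => ?_⟩
  have hl0 : 0 < l := by linarith
  -- The scale at which a ball has volume l^(-q), so that averages of u are at most l.
  set h : ℝ := (l ^ (-q) / unitBallVolume n) ^ ((n : ℝ)⁻¹) with hdef
  have hh : 0 < h := by positivity
  have hhn : h ^ n * unitBallVolume n = l ^ (-q) := by
    rw [hdef, Real.rpow_inv_natCast_pow (by positivity) hn]
    field_simp
  have hE : ∀ x, |stepAvg hh u x| ≤ l := fun x => by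
    have h3 := abs_stepAvg_le hu hh hq h1 x
    rwa [hhn, ← Real.rpow_mul hl0.le, neg_mul_neg, mul_inv_cancel₀ (by linarith),
      Real.rpow_one] at h3
  have h3 : eLpNorm (u - stepAvg hh u) p volume ≤ ENNReal.ofReal (C₀ * h ^ s) :=
    (eLpNorm_sub_stepAvg_le s hs.le hu hh hp).trans (mul_le_of_le_one_right' h2)
  have h4 := measure_le_abs_le volume
    (hu.measurable.sub (measurable_stepAvg hh u)).aestronglyMeasurable hp hp' hl0
    (by positivity) h3
  refine (measure_mono fun x hx => ?_).trans (h4.trans (ENNReal.ofReal_le_ofReal ?_))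
  · have h5 := hE x
    have h6 : 2 * l < |u x| := hx
    have h7 := abs_sub_abs_le_abs_sub (u x) (stepAvg hh u x)
    simp only [Set.mem_ofPred_eq, Pi.sub_apply]
    linarith
  · rw [Real.mul_rpow hC₀0 (by positivity), ← Real.rpow_mul hh.le, hdef,
      ← Real.rpow_mul (by positivity), Real.div_rpow (by positivity) hω.le, Real.rpow_neg hω.le,
      inv_mul_eq_div, neg_add, Real.rpow_add hl0]
    -- Here sp ≥ n enters: the base is at most 1 and the exponent at least 1. The extra power of l
    -- comes from P ≥ 1 below.
    have h5 : (l ^ (-q)) ^ (s * P / n) ≤ l ^ (-q) := by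
      refine Real.rpow_le_self_of_le_one (by positivity)
        (Real.rpow_le_one_of_one_le_of_nonpos hl (by linarith)) ?_
      rwa [one_le_div hn0]
    have h6 : l ^ (-P) ≤ l ^ (-1 : ℝ) := Real.rpow_le_rpow_of_exponent_le hl (by linarith)
    have hW : 0 < unitBallVolume n ^ (s * P / n) := by positivity
    rw [div_eq_mul_inv]
    calc l ^ (-P) * (C₀ ^ P * ((l ^ (-q)) ^ (s * P / n) * (unitBallVolume n ^ (s * P / n))⁻¹))
        ≤ l ^ (-1 : ℝ) * (C₀ ^ P * (l ^ (-q) * (unitBallVolume n ^ (s * P / n))⁻¹)) := by gcongr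
      _ = _ := by ring

theorem exists_measure_abs_gt_le (hn : n ≠ 0) {s : ℝ} (hs : 0 < s) {p : ℝ≥0∞}
    (hp : 1 ≤ p) (hsp : (n : ℝ≥0∞) ≤ ENNReal.ofReal s * p) {q : ℝ} (hq : 1 ≤ q) :
    ∃ C : ℝ, 0 ≤ C ∧ ∀ u : EuclideanSpace ℝ (Fin n) → ℝ, Continuous u →
      eLpNorm u (ENNReal.ofReal q) volume ≤ 1 → gagliardo s p u ≤ 1 → ∀ l : ℝ, 1 ≤ l →
        volume {x | 2 * l < |u x|} ≤ ENNReal.ofReal (C * l ^ (-(1 + q))) := by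
  rcases ne_or_eq p ∞ with hp' | rfl
  · exact exists_measure_abs_gt_le_of_ne_top hn hs hp hp' hsp hq
  have hω := unitBallVolume_pos n
  refine ⟨unitBallVolume n ^ (-q⁻¹) + 2 ^ s, by positivity, fun u hu h1 h2 l hl => ?_⟩
  have hl0 : 0 < l := by linarith
  have hE := abs_stepAvg_le hu one_pos hq h1
  have h3 := (eLpNorm_sub_stepAvg_le s hs.le hu one_pos hp).trans (mul_le_of_le_one_right' h2)
  simp only [one_pow, one_mul, ENNReal.inv_top, ENNReal.toReal_zero, mul_zero, zero_add, neg_zero,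
    Real.rpow_zero, mul_one, Real.one_rpow, eLpNorm_exponent_top] at hE h3
  -- For `p = ∞` and h = 1, u is bounded a.e. by this constant. Beyond it the level set is null;
  -- below it, Chebyshev in L^q suffices, as the missing factor l is at most the constant.
  rcases le_or_gt (unitBallVolume n ^ (-q⁻¹) + 2 ^ s) l with h4 | h4
  · have h5 : volume {x | 2 * l < |u x|} = 0 := by
      refine measure_eq_zero_iff_ae_notMem.2 ?_
      filter_upwards [enorm_ae_le_eLpNormEssSup (u - stepAvg one_pos u) volume] with x hx
      have h6 := hx.trans h3
      rw [Real.enorm_eq_ofReal_abs, ENNReal.ofReal_le_ofReal_iff (by positivity)] at h6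
      have h7 := abs_sub_abs_le_abs_sub (u x) (stepAvg one_pos u x)
      have h8 := hE x
      simp only [not_lt, Pi.sub_apply] at h6 ⊢
      linarith
    rw [h5]
    exact zero_le
  · have h5 := measure_le_abs_le volume hu.aestronglyMeasurable (ENNReal.one_le_ofReal.2 hq)
      ENNReal.ofReal_ne_top hl0 zero_le_one (by simpa using h1)
    rw [ENNReal.toReal_ofReal (by linarith), Real.one_rpow, mul_one] at h5
    refine (measure_mono fun x hx => ?_).trans (h5.trans (ENNReal.ofReal_le_ofReal ?_))
    · have h6 : 2 * l < |u x| := hx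
      simp only [Set.mem_ofPred_eq]
      linarith
    · rw [neg_add, Real.rpow_add hl0, Real.rpow_neg_one, ← mul_assoc]
      refine le_mul_of_one_le_left (by positivity) ?_
      rw [← div_eq_mul_inv, one_le_div hl0]
      exact h4.le

/-- Layer cake, split at t = 2. For t ≤ 2, t^(m-1) is dominated by t^(q-1), which the L^q norm
controls. For t > 2 the weak-type bound leaves t^(m-2-q), integrable because m < 1 + q. -/
theorem exists_eLpNorm_le_of_lt_add_one (hn : n ≠ 0) {s : ℝ} (hs : 0 < s) {p : ℝ≥0∞}
    (hp : 1 ≤ p) (hsp : (n : ℝ≥0∞) ≤ ENNReal.ofReal s * p) {q m : ℝ} (hq : 1 ≤ q) (hqm : q ≤ m)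
    (hm : m < 1 + q) :
    ∃ C : ℝ, 0 < C ∧ ∀ u : EuclideanSpace ℝ (Fin n) → ℝ, Continuous u →
      eLpNorm u (ENNReal.ofReal q) volume ≤ 1 → gagliardo s p u ≤ 1 →
        eLpNorm u (ENNReal.ofReal m) volume ≤ ENNReal.ofReal C := by
  obtain ⟨C, hC0, hC⟩ := exists_measure_abs_gt_le hn hs hp hsp hq
  have hq0 : 0 < q := by linarith
  have hm0 : 0 < m := by linarith
  set J : ℝ≥0∞ := ∫⁻ t in Set.Ioi (2 : ℝ), ENNReal.ofReal (C * 2 ^ (1 + q) * t ^ (m - 1 - (1 + q)))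
    with hJ
  have hJ' : J ≠ ∞ := by
    have h1 : IntegrableOn (fun t : ℝ => C * 2 ^ (1 + q) * t ^ (m - 1 - (1 + q))) (Set.Ioi 2) :=
      (integrableOn_Ioi_rpow_of_lt (by linarith) two_pos).const_mul _
    exact h1.lintegral_lt_top.ne
  set D : ℝ≥0∞ := ENNReal.ofReal m * (ENNReal.ofReal (2 ^ (m - q)) * (ENNReal.ofReal q)⁻¹ + J)
    with hD
  have hD' : D ≠ ∞ := by
    refine ENNReal.mul_ne_top ENNReal.ofReal_ne_top (ENNReal.add_ne_top.2
      ⟨ENNReal.mul_ne_top ENNReal.ofReal_ne_top (ENNReal.inv_ne_top.2 ?_), hJ'⟩)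
    simpa using hq0
  refine ⟨(D.toReal + 1) ^ m⁻¹, by positivity, fun u hu h1 h2 => ?_⟩
  have hlay : ∀ {a : ℝ}, 0 < a → eLpNorm u (ENNReal.ofReal a) volume ^ a =
      ENNReal.ofReal a *
        ∫⁻ t in Set.Ioi (0 : ℝ), volume {x | t < |u x|} * ENNReal.ofReal (t ^ (a - 1)) :=
    fun {a} ha => by
      rw [← lintegral_ofReal_abs_rpow volume u ha]
      exact lintegral_rpow_eq_lintegral_meas_lt_mul volume (ae_of_all _ fun x => abs_nonneg _)
        hu.abs.measurable.aemeasurable ha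
  have hI : ∫⁻ t in Set.Ioi (0 : ℝ), volume {x | t < |u x|} * ENNReal.ofReal (t ^ (q - 1)) ≤
      (ENNReal.ofReal q)⁻¹ := by
    rw [ENNReal.le_inv_iff_mul_le, mul_comm, ← hlay hq0]
    exact ENNReal.rpow_le_one h1 hq0.le
  have hpt : ∀ t ∈ Set.Ioi (0 : ℝ), volume {x | t < |u x|} * ENNReal.ofReal (t ^ (m - 1)) ≤
      ENNReal.ofReal (2 ^ (m - q)) * (volume {x | t < |u x|} * ENNReal.ofReal (t ^ (q - 1))) +
        (Set.Ioi (2 : ℝ)).indicator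
          (fun t => ENNReal.ofReal (C * 2 ^ (1 + q) * t ^ (m - 1 - (1 + q)))) t := by
    intro t ht
    have ht : 0 < t := ht
    rcases le_or_gt t 2 with h3 | h3
    · refine le_add_right ?_
      rw [mul_left_comm, ← ENNReal.ofReal_mul (by positivity)]
      gcongr
      calc t ^ (m - 1) = t ^ (m - q) * t ^ (q - 1) := by
            rw [← Real.rpow_add ht]
            ring_nf
        _ ≤ _ := by
            gcongr
    · refine le_add_left ?_
      rw [Set.indicator_of_mem (show t ∈ Set.Ioi (2 : ℝ) from h3)]
      have h4 := hC u hu h1 h2 (t / 2) (by linarith)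
      rw [mul_div_cancel₀ _ two_ne_zero] at h4
      refine (mul_le_mul_left h4 _).trans ?_
      rw [← ENNReal.ofReal_mul (by positivity)]
      refine ENNReal.ofReal_le_ofReal (le_of_eq ?_)
      rw [Real.div_rpow ht.le two_pos.le, Real.rpow_neg two_pos.le (1 + q), sub_eq_add_neg (m - 1),
        Real.rpow_add ht]
      field_simp
  have hmeas : Measurable fun t : ℝ => volume {x | t < |u x|} * ENNReal.ofReal (t ^ (q - 1)) := by
    have h3 : Antitone fun t : ℝ => volume {x | t < |u x|} :=
      fun a b hab => measure_mono fun x hx => lt_of_le_of_lt hab hx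
    exact h3.measurable.mul (by fun_prop)
  have hmain : eLpNorm u (ENNReal.ofReal m) volume ^ m ≤ D := by
    rw [hlay hm0, hD]
    gcongr
    calc _ ≤ _ := setLIntegral_mono' measurableSet_Ioi hpt
      _ = ENNReal.ofReal (2 ^ (m - q)) *
            (∫⁻ t in Set.Ioi (0 : ℝ), volume {x | t < |u x|} * ENNReal.ofReal (t ^ (q - 1))) +
          ∫⁻ t in Set.Ioi (0 : ℝ), (Set.Ioi (2 : ℝ)).indicator
            (fun t => ENNReal.ofReal (C * 2 ^ (1 + q) * t ^ (m - 1 - (1 + q)))) t := by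
          rw [lintegral_add_left (hmeas.const_mul _), lintegral_const_mul _ hmeas]
      _ ≤ _ := by
          gcongr
          rw [lintegral_indicator measurableSet_Ioi, Measure.restrict_restrict measurableSet_Ioi]
          exact lintegral_mono_set Set.inter_subset_left
  rw [← ENNReal.ofReal_rpow_of_nonneg (by positivity) (by positivity), ENNReal.le_rpow_inv_iff hm0]
  refine hmain.trans ?_
  rw [ENNReal.le_ofReal_iff_toReal_le hD' (by positivity)]
  linarith

theorem gagliardo_smul (s : ℝ) (p : ℝ≥0∞) (c : ℝ) (u : EuclideanSpace ℝ (Fin n) → ℝ) :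
    gagliardo s p (c • u) = ‖c‖ₑ * gagliardo s p u := by
  simp only [gagliardo, diffQuot_smul, eLpNorm_const_smul]

/-- Divide u by B; since B ≥ 1, the seminorm bound survives the scaling. -/
theorem eLpNorm_le_of_le_one_imp_le {s : ℝ} {p : ℝ≥0∞} {q m C : ℝ}
    (H : ∀ u : EuclideanSpace ℝ (Fin n) → ℝ, Continuous u →
      eLpNorm u (ENNReal.ofReal q) volume ≤ 1 → gagliardo s p u ≤ 1 →
        eLpNorm u (ENNReal.ofReal m) volume ≤ ENNReal.ofReal C)
    {B : ℝ} (hB : 1 ≤ B) {u : EuclideanSpace ℝ (Fin n) → ℝ} (hu : Continuous u)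
    (hu1 : eLpNorm u (ENNReal.ofReal q) volume ≤ ENNReal.ofReal B) (hu2 : gagliardo s p u ≤ 1) :
    eLpNorm u (ENNReal.ofReal m) volume ≤ ENNReal.ofReal (B * C) := by
  have hB0 : 0 < B := by linarith
  have hBe : ‖B⁻¹‖ₑ = (ENNReal.ofReal B)⁻¹ := by
    rw [Real.enorm_of_nonneg (by positivity), ENNReal.ofReal_inv_of_pos hB0]
  have hB2 : ENNReal.ofReal B ≠ 0 := by simpa using hB0
  have h5 : eLpNorm (B⁻¹ • u) (ENNReal.ofReal q) volume ≤ 1 := by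
    rw [eLpNorm_const_smul, hBe, mul_comm, ← div_eq_mul_inv]
    refine ENNReal.div_le_of_le_mul ?_
    rwa [one_mul]
  have h6 : gagliardo s p (B⁻¹ • u) ≤ 1 := by
    rw [gagliardo_smul, hBe, mul_comm, ← div_eq_mul_inv]
    refine ENNReal.div_le_of_le_mul ?_
    rw [one_mul]
    exact hu2.trans (by simpa using hB)
  have h7 := H (B⁻¹ • u) (hu.const_smul _) h5 h6
  rw [eLpNorm_const_smul, hBe, mul_comm, ← div_eq_mul_inv,
    ENNReal.div_le_iff hB2 ENNReal.ofReal_ne_top] at h7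
  rwa [ENNReal.ofReal_mul hB0.le, mul_comm]

/-- The embedding of `L^q ∩ W^{s,p}` into all `L^m` with `q ≤ m < ∞` if `sp ≥ n`. -/
theorem exists_eLpNorm_le (hn : n ≠ 0) {s : ℝ} (hs : 0 < s) {p : ℝ≥0∞}
    (hp : 1 ≤ p) (hsp : (n : ℝ≥0∞) ≤ ENNReal.ofReal s * p) {q m : ℝ} (hq : 1 ≤ q) (hqm : q ≤ m) :
    ∃ C : ℝ, 0 < C ∧ ∀ u : EuclideanSpace ℝ (Fin n) → ℝ, Continuous u →
      eLpNorm u (ENNReal.ofReal q) volume ≤ 1 → gagliardo s p u ≤ 1 →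
        eLpNorm u (ENNReal.ofReal m) volume ≤ ENNReal.ofReal C := by
  -- Each application gains any amount less than 1 in the exponent; the induction advances by 1/2.
  suffices H : ∀ k : ℕ, ∀ m : ℝ, q ≤ m → m ≤ q + k / 2 → ∃ C : ℝ, 0 < C ∧
      ∀ u : EuclideanSpace ℝ (Fin n) → ℝ, Continuous u →
      eLpNorm u (ENNReal.ofReal q) volume ≤ 1 → gagliardo s p u ≤ 1 →
        eLpNorm u (ENNReal.ofReal m) volume ≤ ENNReal.ofReal C by
    obtain ⟨k, hk⟩ := exists_nat_ge (2 * (m - q))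
    exact H k m hqm (by linarith)
  intro k
  induction k with
  | zero =>
    intro m h1 h2
    obtain rfl : q = m := by
      push_cast at h2
      linarith
    exact ⟨1, one_pos, fun u _ h _ => by simpa using h⟩
  | succ k ih =>
    intro m h1 h2
    push_cast at h2
    -- The intermediate exponent is half a step below m, but never below q.
    have h3 : m - 1 / 2 ≤ max q (m - 1 / 2) := le_max_right _ _
    have h4 : q ≤ max q (m - 1 / 2) := le_max_left _ _
    have hk : (0 : ℝ) ≤ k := k.cast_nonneg
    obtain ⟨C₁, hC₁, H₁⟩ := ih (max q (m - 1 / 2)) h4 (max_le (by linarith) (by linarith))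
    obtain ⟨C₂, hC₂, H₂⟩ := exists_eLpNorm_le_of_lt_add_one hn hs hp hsp (hq.trans h4)
      (max_le h1 (by linarith)) (show m < 1 + max q (m - 1 / 2) by linarith)
    exact ⟨max 1 C₁ * C₂, by positivity, fun u hu hu1 hu2 =>
      eLpNorm_le_of_le_one_imp_le H₂ (le_max_left _ _) hu
        ((H₁ u hu hu1 hu2).trans (ENNReal.ofReal_le_ofReal (le_max_right _ _))) hu2⟩

end Embedding

end WeightedFractionalSobolev

/-! ### Weighted Hölder inequality and weighted embedding -/

namespace WeightedFractionalSobolev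

open Metric

section Weights

/-- For w > 0 this is an identity: the powers of v cancel, those of k add up to 1 and those of w to
r. This dictates the form of ψ. -/
theorem rpow_mul_le_of_exponents {r q q' τ : ℝ} (hr : 0 < r) (hrq : r < q) (hq' : q < q')
    (hτ0 : 0 < τ) {w k v : ℝ} (hw : 0 ≤ w) (hk : 0 < k) (hv : 0 < v) :
    w ^ r * k ≤ (w ^ q * v) ^ (τ * ((q' - r) / (q' + τ * (q' - q)))) *
      (w ^ q') ^ ((r - τ * (q - r)) / (q' + τ * (q' - q))) *
      (k ^ ((q' + τ * (q' - q)) / (q' - r)) * v ^ (-τ)) ^ ((q' - r) / (q' + τ * (q' - q))) := by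
  have hd : 0 < q' - r := by linarith
  have hD : 0 < q' + τ * (q' - q) := by
    have : 0 < τ * (q' - q) := mul_pos hτ0 (by linarith)
    linarith
  rcases hw.eq_or_lt with rfl | hw
  · rw [Real.zero_rpow hr.ne', zero_mul]
    positivity
  · refine le_of_eq ?_
    rw [Real.mul_rpow (by positivity) hv.le, Real.mul_rpow (by positivity) (by positivity),
      ← Real.rpow_mul hw.le, ← Real.rpow_mul hw.le, ← Real.rpow_mul hk.le, ← Real.rpow_mul hv.le,
      div_mul_div_cancel₀ hd.ne', div_self hD.ne', Real.rpow_one, neg_mul, Real.rpow_neg hv.le]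
    have h1 : w ^ r = w ^ (q * (τ * ((q' - r) / (q' + τ * (q' - q))))) *
        w ^ (q' * ((r - τ * (q - r)) / (q' + τ * (q' - q)))) := by
      rw [← Real.rpow_add hw]
      congr 1
      field_simp
      ring
    have h2 : 0 < v ^ (τ * ((q' - r) / (q' + τ * (q' - q)))) := by positivity
    rw [h1]
    field_simp

/-- Hölder's inequality with three factors, for weights. -/
theorem lintegral_rpow_mul_le {α : Type*} [MeasurableSpace α] (μ : Measure α) {w K V : α → ℝ}
    (hw : AEMeasurable w μ) (hKm : AEMeasurable K μ) (hVm : AEMeasurable V μ)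
    (hw0 : ∀ x, 0 ≤ w x) (hK : ∀ x, 0 < K x) (hV : ∀ x, 0 < V x)
    {r q q' τ : ℝ} (hr : 0 < r) (hrq : r < q) (hq' : q < q') (hτ0 : 0 < τ) (hτ1 : τ ≤ r / (q - r)) :
    ∫⁻ x, ENNReal.ofReal (w x ^ r * K x) ∂μ ≤
      (∫⁻ x, ENNReal.ofReal (w x ^ q * V x) ∂μ) ^ (τ * ((q' - r) / (q' + τ * (q' - q)))) *
      (∫⁻ x, ENNReal.ofReal (w x ^ q') ∂μ) ^ ((r - τ * (q - r)) / (q' + τ * (q' - q))) *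
      (∫⁻ x, ENNReal.ofReal (K x ^ ((q' + τ * (q' - q)) / (q' - r)) * V x ^ (-τ)) ∂μ) ^
        ((q' - r) / (q' + τ * (q' - q))) := by
  have hd : 0 < q' - r := by linarith
  have hD : 0 < q' + τ * (q' - q) := by
    have : 0 < τ * (q' - q) := mul_pos hτ0 (by linarith)
    linarith
  -- The upper bound on τ is exactly the nonnegativity of the middle Hölder exponent.
  have hb : 0 ≤ r - τ * (q - r) := by
    rw [le_div_iff₀ (by linarith)] at hτ1
    linarith
  have ha0 : 0 ≤ τ * ((q' - r) / (q' + τ * (q' - q))) := by positivity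
  have hb0 : 0 ≤ (r - τ * (q - r)) / (q' + τ * (q' - q)) := by positivity
  have hc0 : 0 ≤ (q' - r) / (q' + τ * (q' - q)) := by positivity
  have key := ENNReal.lintegral_prod_norm_pow_le (μ := μ) (Finset.univ : Finset (Fin 3))
    (f := ![fun x => ENNReal.ofReal (w x ^ q * V x), fun x => ENNReal.ofReal (w x ^ q'),
      fun x => ENNReal.ofReal (K x ^ ((q' + τ * (q' - q)) / (q' - r)) * V x ^ (-τ))])
    (p := ![τ * ((q' - r) / (q' + τ * (q' - q))), (r - τ * (q - r)) / (q' + τ * (q' - q)),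
      (q' - r) / (q' + τ * (q' - q))])
    (by
      intro i _
      fin_cases i
      · exact ((hw.pow_const q).mul hVm).ennreal_ofReal
      · exact (hw.pow_const q').ennreal_ofReal
      · exact ((hKm.pow_const _).mul (hVm.pow_const _)).ennreal_ofReal)
    (by
      simp only [Fin.sum_univ_three, Matrix.cons_val]
      field_simp
      ring)
    (by
      intro i _
      fin_cases i
      · exact ha0
      · exact hb0
      · exact hc0)
  simp only [Fin.prod_univ_three, Matrix.cons_val] at key
  refine (lintegral_mono fun x => ?_).trans key
  have h0 := hw0 x
  have h1 := hK x
  have h2 := hV x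
  rw [ENNReal.ofReal_rpow_of_nonneg (by positivity) ha0,
    ENNReal.ofReal_rpow_of_nonneg (by positivity) hb0,
    ENNReal.ofReal_rpow_of_nonneg (by positivity) hc0, ← ENNReal.ofReal_mul (by positivity),
    ← ENNReal.ofReal_mul (by positivity)]
  exact ENNReal.ofReal_le_ofReal (rpow_mul_le_of_exponents hr hrq hq' hτ0 h0 h1 h2)

variable {n : ℕ}

theorem eLpNorm_weighted_rpow {W u : EuclideanSpace ℝ (Fin n) → ℝ} (hW : AEMeasurable W volume)
    (hu : Measurable u) {q : ℝ} (hq : 0 < q)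
    {A : Set (EuclideanSpace ℝ (Fin n))} (hA : MeasurableSet A) :
    eLpNorm u (ENNReal.ofReal q) ((weighted W).restrict A) ^ q =
      ∫⁻ x in A, ENNReal.ofReal (|u x| ^ q * W x) := by
  rw [← lintegral_ofReal_abs_rpow _ u hq, weighted, restrict_withDensity hA,
    lintegral_withDensity_eq_lintegral_mul₀ hW.restrict.ennreal_ofReal (by fun_prop)]
  refine lintegral_congr fun x => ?_
  rw [Pi.mul_apply, ENNReal.ofReal_mul (by positivity), mul_comm]

/-- The lower bound on V gives dx ≤ V₀⁻¹ V dx as measures. -/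
theorem eLpNorm_le_eLpNorm_weighted {V u : EuclideanSpace ℝ (Fin n) → ℝ}
    {V₀ : ℝ} (hV₀ : 0 < V₀) (hV : ∀ x, V₀ ≤ V x) (p : ℝ≥0∞) (hp : p ≠ ∞) :
    eLpNorm u p volume ≤ ENNReal.ofReal V₀⁻¹ ^ (1 / p).toReal * eLpNorm u p (weighted V) := by
  have h1 : (volume : Measure (EuclideanSpace ℝ (Fin n))) ≤
      ENNReal.ofReal V₀⁻¹ • weighted V := by
    refine Measure.le_iff.2 fun A hA => ?_
    rw [Measure.smul_apply, weighted, withDensity_apply _ hA, smul_eq_mul,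
      ENNReal.ofReal_inv_of_pos hV₀]
    have h2 : ENNReal.ofReal V₀ * volume A ≤ ∫⁻ x in A, ENNReal.ofReal (V x) := by
      rw [← setLIntegral_const]
      exact lintegral_mono fun x => ENNReal.ofReal_le_ofReal (hV x)
    rw [mul_comm, ← div_eq_mul_inv, ENNReal.le_div_iff_mul_le (Or.inl (by simpa using hV₀))
      (Or.inl ENNReal.ofReal_ne_top), mul_comm]
    exact h2
  refine (eLpNorm_mono_measure u h1).trans ?_
  rw [eLpNorm_smul_measure_of_ne_top hp, smul_eq_mul]

/-- The weighted embedding, with the dependence on the domain of integration. -/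
theorem exists_eLpNorm_weighted_restrict_le (hn : n ≠ 0) {s : ℝ} (hs : 0 < s) {p : ℝ≥0∞}
    (hp : 1 ≤ p) (hsp : (n : ℝ≥0∞) ≤ ENNReal.ofReal s * p) {r q q' τ : ℝ} (hr : 1 ≤ r)
    (hrq : r < q) (hq' : q < q') (hτ0 : 0 < τ) (hτ1 : τ ≤ r / (q - r))
    {K V : EuclideanSpace ℝ (Fin n) → ℝ} (hKm : AEMeasurable K volume)
    (hVm : AEMeasurable V volume) (hK0 : ∀ x, 0 < K x)
    {V₀ : ℝ} (hV₀ : 0 < V₀) (hV : ∀ x, V₀ ≤ V x) :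
    ∃ C : ℝ, 0 < C ∧ ∀ u : EuclideanSpace ℝ (Fin n) → ℝ, Continuous u →
      ∀ N : ℝ, 0 < N → eNormMV s q p V u ≤ ENNReal.ofReal N →
      ∀ A : Set (EuclideanSpace ℝ (Fin n)), MeasurableSet A →
        eLpNorm u (ENNReal.ofReal r) ((weighted K).restrict A) ≤ ENNReal.ofReal (C * N) *
          (∫⁻ x in A, ENNReal.ofReal
            (K x ^ ((q' + τ * (q' - q)) / (q' - r)) * V x ^ (-τ))) ^
              ((q' - r) / (q' + τ * (q' - q)) / r) := by
  obtain ⟨C₁, hC₁, H₁⟩ := exists_eLpNorm_le hn hs hp hsp (hr.trans hrq.le) hq'.le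
  have hr0 : 0 < r := by linarith
  have hq0 : 0 < q := by linarith
  have hq'0 : 0 < q' := by linarith
  -- Bounds the unweighted L^q norm on the unit ball; the maximum with 1 is what rescaling requires.
  set B : ℝ := max 1 (V₀⁻¹ ^ (1 / ENNReal.ofReal q).toReal) with hB
  have hB1 : 1 ≤ B := le_max_left _ _
  have hd : 0 < q' - r := by linarith
  have hD : 0 < q' + τ * (q' - q) := by
    have : 0 < τ * (q' - q) := mul_pos hτ0 (by linarith)
    linarith
  have hb : 0 ≤ r - τ * (q - r) := by
    rw [le_div_iff₀ (by linarith)] at hτ1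
    linarith
  have ha0 : 0 ≤ τ * ((q' - r) / (q' + τ * (q' - q))) := by positivity
  set b : ℝ := (r - τ * (q - r)) / (q' + τ * (q' - q))
  have hb0 : 0 ≤ b := by positivity
  set c : ℝ := (q' - r) / (q' + τ * (q' - q))
  have hc0 : 0 ≤ c := by positivity
  refine ⟨(((B * C₁) ^ q') ^ b) ^ r⁻¹, by positivity, fun u hu N hN huN A hA => ?_⟩
  set G : EuclideanSpace ℝ (Fin n) → ℝ :=
    fun x => K x ^ ((q' + τ * (q' - q)) / (q' - r)) * V x ^ (-τ) with hG
  -- The Hölder bound is proved for norm at most 1 and then scaled back by N.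
  set v : EuclideanSpace ℝ (Fin n) → ℝ := N⁻¹ • u with hv
  have hvc : Continuous v := hu.const_smul _
  have hNe : ‖N⁻¹‖ₑ = (ENNReal.ofReal N)⁻¹ := by
    rw [Real.enorm_of_nonneg (by positivity), ENNReal.ofReal_inv_of_pos hN]
  have hN2 : ENNReal.ofReal N ≠ 0 := by simpa using hN
  have hv1 : eNormMV s q p V v ≤ 1 := by
    rw [hv, eNormMV_smul, hNe, mul_comm, ← div_eq_mul_inv]
    refine ENNReal.div_le_of_le_mul ?_
    rwa [one_mul]
  have hvq : eLpNorm v (ENNReal.ofReal q) (weighted V) ≤ 1 := le_self_add.trans hv1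
  have hvq' : eLpNorm v (ENNReal.ofReal q) volume ≤ ENNReal.ofReal B := by
    refine (eLpNorm_le_eLpNorm_weighted hV₀ hV _ ENNReal.ofReal_ne_top).trans
      ((mul_le_of_le_one_right' hvq).trans ?_)
    rw [ENNReal.ofReal_rpow_of_nonneg (by positivity) ENNReal.toReal_nonneg]
    exact ENNReal.ofReal_le_ofReal (le_max_right _ _)
  have hvm := eLpNorm_le_of_le_one_imp_le H₁ hB1 hvc hvq' (le_add_self.trans hv1)
  have key := lintegral_rpow_mul_le (volume.restrict A) hvc.abs.measurable.aemeasurable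
    hKm.restrict hVm.restrict (fun x => abs_nonneg _) hK0 (fun x => hV₀.trans_le (hV x)) hr0 hrq
    hq' hτ0 hτ1
  have h1 : ∫⁻ x in A, ENNReal.ofReal (|v x| ^ q * V x) ≤ 1 := by
    rw [← eLpNorm_weighted_rpow hVm hvc.measurable hq0 hA]
    exact ENNReal.rpow_le_one ((eLpNorm_restrict_le _ _ _ _).trans hvq) hq0.le
  have h2 : ∫⁻ x in A, ENNReal.ofReal (|v x| ^ q') ≤ ENNReal.ofReal ((B * C₁) ^ q') := by
    rw [lintegral_ofReal_abs_rpow _ _ hq'0, ← ENNReal.ofReal_rpow_of_nonneg (by positivity) hq'0.le]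
    gcongr
    exact (eLpNorm_restrict_le _ _ _ _).trans hvm
  have h3 : eLpNorm v (ENNReal.ofReal r) ((weighted K).restrict A) ^ r ≤
      ENNReal.ofReal (((B * C₁) ^ q') ^ b) * (∫⁻ x in A, ENNReal.ofReal (G x)) ^ c := by
    rw [eLpNorm_weighted_rpow hKm hvc.measurable hr0 hA]
    refine key.trans ?_
    gcongr
    refine (mul_le_of_le_one_left' (ENNReal.rpow_le_one h1 ha0)).trans ?_
    rw [← ENNReal.ofReal_rpow_of_nonneg (by positivity) hb0]
    gcongr
  have h4 : eLpNorm v (ENNReal.ofReal r) ((weighted K).restrict A) ≤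
      ENNReal.ofReal ((((B * C₁) ^ q') ^ b) ^ r⁻¹) *
        (∫⁻ x in A, ENNReal.ofReal (G x)) ^ (c / r) := by
    rw [← ENNReal.rpow_le_rpow_iff hr0, ENNReal.mul_rpow_of_nonneg _ _ hr0.le,
      ENNReal.ofReal_rpow_of_nonneg (by positivity) hr0.le, ← Real.rpow_mul (by positivity),
      inv_mul_cancel₀ hr0.ne', Real.rpow_one, ← ENNReal.rpow_mul, div_mul_cancel₀ _ hr0.ne']
    exact h3
  rw [hv, eLpNorm_const_smul, hNe, mul_comm, ← div_eq_mul_inv,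
    ENNReal.div_le_iff hN2 ENNReal.ofReal_ne_top] at h4
  rw [ENNReal.ofReal_mul (by positivity), mul_right_comm]
  exact h4

end Weights

end WeightedFractionalSobolev

/-! ### Finitely many averages determine a function approximately -/

namespace WeightedFractionalSobolev

open Metric Filter Topology

section Compactness

variable {n : ℕ}

theorem gagliardo_le_eNormMV {s q : ℝ} {p : ℝ≥0∞} {V u : EuclideanSpace ℝ (Fin n) → ℝ} :
    gagliardo s p u ≤ eNormMV s q p V u :=
  le_add_self

/-- Uniform approximation in measure by averages, on a set of finite measure. -/
theorem exists_volume_inter_le {s : ℝ} (hs : 0 < s) {p : ℝ≥0∞} (hp : 1 ≤ p)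
    {F : Set (EuclideanSpace ℝ (Fin n))} (hF' : volume F ≠ ∞) {l ρ : ℝ} (hl : 0 < l) (hρ : 0 < ρ) :
    ∃ (h : ℝ) (hh : 0 < h), ∀ u : EuclideanSpace ℝ (Fin n) → ℝ, Continuous u →
      gagliardo s p u ≤ 1 →
        (volume.restrict F) {x | l ≤ |u x - stepAvg hh u x|} ≤ ENNReal.ofReal ρ := by
  have hω := unitBallVolume_pos n
  -- The Hölder constant from L^p to L^1 on F. At `p = ∞`, `p.toReal` is 0 and 1/0 = 0, which gives
  -- the correct exponent 1.
  set v : ℝ := ((volume F) ^ (1 - 1 / p.toReal)).toReal with hv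
  set A₀ : ℝ := 2 ^ ((n : ℝ) * (p⁻¹).toReal + s) * unitBallVolume n ^ (-(p⁻¹).toReal) with hA₀
  have hA₀0 : 0 < A₀ := by positivity
  have hv0 : 0 ≤ v := ENNReal.toReal_nonneg
  have he : 0 ≤ 1 - 1 / p.toReal := by
    rcases eq_or_ne p ∞ with rfl | hp'
    · simp
    · have : 1 ≤ p.toReal := by simpa using ENNReal.toReal_mono hp' hp
      rw [sub_nonneg, div_le_one (by linarith)]
      exact this
  have hvF : (volume F) ^ (1 - 1 / p.toReal) = ENNReal.ofReal v :=
    (ENNReal.ofReal_toReal (ENNReal.rpow_ne_top_of_nonneg he hF')).symm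
  -- Chosen so that Chebyshev in L^1 gives ρ v/(v + 1) ≤ ρ; the +1 avoids division by zero.
  set h : ℝ := (ρ * l / (A₀ * (v + 1))) ^ s⁻¹ with hdef
  have hh : 0 < h := by positivity
  have hhs : h ^ s = ρ * l / (A₀ * (v + 1)) := by
    rw [hdef, ← Real.rpow_mul (by positivity), inv_mul_cancel₀ hs.ne', Real.rpow_one]
  refine ⟨h, hh, fun u hu hu1 => ?_⟩
  have hm : AEStronglyMeasurable (u - stepAvg hh u) (volume.restrict F) :=
    (hu.measurable.sub (measurable_stepAvg hh u)).aestronglyMeasurable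
  have h1 : eLpNorm (u - stepAvg hh u) 1 (volume.restrict F) ≤
      ENNReal.ofReal (A₀ * h ^ s * v) := by
    refine (eLpNorm_le_eLpNorm_mul_rpow_measure_univ hp hm).trans ?_
    rw [Measure.restrict_apply_univ, ENNReal.toReal_one, one_div_one, hvF,
      ENNReal.ofReal_mul (by positivity)]
    gcongr
    exact (eLpNorm_restrict_le _ _ _ _).trans
      ((eLpNorm_sub_stepAvg_le s hs.le hu hh hp).trans (mul_le_of_le_one_right' hu1))
  refine (measure_le_abs_le _ hm le_rfl ENNReal.one_ne_top hl (by positivity) h1).trans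
    (ENNReal.ofReal_le_ofReal ?_)
  rw [ENNReal.toReal_one, Real.rpow_neg_one, Real.rpow_one, hhs]
  calc l⁻¹ * (A₀ * (ρ * l / (A₀ * (v + 1))) * v) = ρ * (v / (v + 1)) := by field_simp
    _ ≤ ρ * 1 := by
      gcongr
      rw [div_le_one (by positivity)]
      linarith
    _ = ρ := mul_one ρ

theorem eLpNorm_le_add_compl {α F : Type*} [MeasurableSpace α] [NormedAddCommGroup F]
    (μ : Measure α) {f : α → F} (hf : AEStronglyMeasurable f μ) {p : ℝ≥0∞} (hp : 1 ≤ p) {B : Set α}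
    (hB : MeasurableSet B) :
    eLpNorm f p μ ≤ eLpNorm f p (μ.restrict B) + eLpNorm f p (μ.restrict Bᶜ) := by
  rw [← eLpNorm_indicator_eq_eLpNorm_restrict hB, ← eLpNorm_indicator_eq_eLpNorm_restrict hB.compl]
  conv_lhs => rw [← Set.indicator_self_add_compl B f]
  exact eLpNorm_add_le (hf.indicator hB) (hf.indicator hB.compl) hp

/-- Continuity from above of the finite measure g dx along sets decreasing to ∅. -/
theorem exists_setLIntegral_compl_closedBall_lt {g : EuclideanSpace ℝ (Fin n) → ℝ≥0∞}
    (hg : ∫⁻ x, g x ≠ ∞) {ε : ℝ≥0∞} (hε : 0 < ε) :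
    ∃ j : ℕ, ∫⁻ x in (closedBall 0 (j : ℝ))ᶜ, g x < ε := by
  have h1 : Tendsto (fun j : ℕ =>
      (volume.withDensity g) (closedBall (0 : EuclideanSpace ℝ (Fin n)) (j : ℝ))ᶜ) atTop
      (𝓝 ((volume.withDensity g) (⋂ j : ℕ, (closedBall 0 (j : ℝ))ᶜ))) := by
    refine tendsto_measure_iInter_atTop
      (fun j => measurableSet_closedBall.compl.nullMeasurableSet) ?_ ⟨0, ?_⟩
    · intro i j hij
      exact Set.compl_subset_compl.2 (closedBall_subset_closedBall (by exact_mod_cast hij))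
    · refine ((measure_mono (Set.subset_univ _)).trans_lt ?_).ne
      rw [withDensity_apply _ MeasurableSet.univ, Measure.restrict_univ]
      exact hg.lt_top
  have h2 : (⋂ j : ℕ, (closedBall (0 : EuclideanSpace ℝ (Fin n)) (j : ℝ))ᶜ) = ∅ := by
    rw [← Set.compl_iUnion, iUnion_closedBall_nat, Set.compl_univ]
  rw [h2, measure_empty] at h1
  obtain ⟨j, hj⟩ := (h1.eventually (gt_mem_nhds hε)).exists
  rw [withDensity_apply _ measurableSet_closedBall.compl] at hj
  exact ⟨j, hj⟩

/-- Again continuity from above. Off a set of small measure in F, `stepAvg` involves only the first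
M averages. -/
theorem exists_volume_nearIndex_ge_lt {h : ℝ} (hh : 0 < h)
    {F : Set (EuclideanSpace ℝ (Fin n))} (hF' : volume F ≠ ∞) {ε : ℝ≥0∞} (hε : 0 < ε) :
    ∃ M : ℕ, (volume.restrict F) {x | M ≤ nearIndex hh x} < ε := by
  have h1 : Tendsto (fun M : ℕ => (volume.restrict F) {x | M ≤ nearIndex hh x}) atTop
      (𝓝 ((volume.restrict F) (⋂ M : ℕ, {x | M ≤ nearIndex hh x}))) := by
    refine tendsto_measure_iInter_atTop
      (fun j => (measurable_nearIndex hh measurableSet_Ici).nullMeasurableSet) ?_ ⟨0, ?_⟩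
    · exact fun i j hij x hx => le_trans hij hx
    · refine ((measure_mono (Set.subset_univ _)).trans_lt ?_).ne
      rw [Measure.restrict_apply_univ]
      exact hF'.lt_top
  have h2 : (⋂ M : ℕ, {x : EuclideanSpace ℝ (Fin n) | M ≤ nearIndex hh x}) = ∅ := by
    refine Set.eq_empty_of_forall_notMem fun x hx => ?_
    have h3 : nearIndex hh x + 1 ≤ nearIndex hh x := Set.mem_iInter.1 hx (nearIndex hh x + 1)
    omega
  rw [h2, measure_empty] at h1
  exact (h1.eventually (gt_mem_nhds hε)).exists

theorem weighted_lt_top_of_memLp {K : EuclideanSpace ℝ (Fin n) → ℝ} {t : ℝ≥0∞} (ht : 1 ≤ t)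
    {D : Set (EuclideanSpace ℝ (Fin n))} (hD : MeasurableSet D) (hD' : volume D ≠ ∞)
    (hKt : MemLp K t (volume.restrict D)) : weighted K D < ∞ := by
  have : IsFiniteMeasure (volume.restrict D) := ⟨by
    rw [Measure.restrict_apply_univ]
    exact hD'.lt_top⟩
  rw [weighted, withDensity_apply _ hD]
  exact (hKt.integrable ht).lintegral_lt_top

/-- On the unit ball, finitely many averages determine a function up to a small error in the
weighted space. -/
theorem exists_eLpNorm_sub_le_of_ballAvg (hn : n ≠ 0) {s : ℝ} (hs : 0 < s) {p : ℝ≥0∞}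
    (hp : 1 ≤ p) (hsp : (n : ℝ≥0∞) ≤ ENNReal.ofReal s * p) {r q q' τ : ℝ} (hr : 1 ≤ r)
    (hrq : r < q) (hq' : q < q') (hτ0 : 0 < τ) (hτ1 : τ ≤ r / (q - r))
    {K V : EuclideanSpace ℝ (Fin n) → ℝ} (hKm : AEMeasurable K volume)
    (hVm : AEMeasurable V volume) (hK0 : ∀ x, 0 < K x)
    (hK : ∀ R : ℝ, weighted K (closedBall 0 R) < ∞)
    {V₀ : ℝ} (hV₀ : 0 < V₀) (hV : ∀ x, V₀ ≤ V x)
    (hKV : ∫⁻ x, ENNReal.ofReal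
      (K x ^ ((q' + τ * (q' - q)) / (q' - r)) * V x ^ (-τ)) ≠ ∞)
    {ε : ℝ} (hε : 0 < ε) :
    ∃ h > 0, ∃ M : ℕ, ∃ δ > 0, ∀ u v : EuclideanSpace ℝ (Fin n) → ℝ, Continuous u →
      Continuous v → eNormMV s q p V u ≤ 1 → eNormMV s q p V v ≤ 1 →
      (∀ k < M, |ballAvg u (TopologicalSpace.denseSeq _ k) h -
        ballAvg v (TopologicalSpace.denseSeq _ k) h| < δ) →
      eLpNorm (u - v) (ENNReal.ofReal r) (weighted K) ≤ ENNReal.ofReal ε := by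
  obtain ⟨C, hC, H⟩ := exists_eLpNorm_weighted_restrict_le hn hs hp hsp hr hrq hq' hτ0 hτ1 hKm hVm
    hK0 hV₀ hV
  set G : EuclideanSpace ℝ (Fin n) → ℝ≥0∞ := fun x => ENNReal.ofReal
    (K x ^ ((q' + τ * (q' - q)) / (q' - r)) * V x ^ (-τ)) with hG
  have hr0 : 0 < r := by linarith
  set a : ℝ := (q' - r) / (q' + τ * (q' - q)) / r with ha
  have ha0 : 0 < a := by
    have hd : 0 < q' - r := by linarith
    have hD : 0 < q' + τ * (q' - q) := by
      have : 0 < τ * (q' - q) := mul_pos hτ0 (by linarith)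
      linarith
    positivity
  -- Solves C · 2 · η^a = ε/2, where 2 bounds the norm of u - v. Half of η goes to the tail outside
  -- F, half to the exceptional set in F.
  set η : ℝ := (ε / 2 / (C * 2)) ^ a⁻¹ with hη
  have hη0 : 0 < η := by positivity
  obtain ⟨j, hj⟩ := exists_setLIntegral_compl_closedBall_lt hKV (ε := ENNReal.ofReal (η / 2))
    (by simpa using hη0)
  set F : Set (EuclideanSpace ℝ (Fin n)) := closedBall 0 (j : ℝ) with hF
  have hFm : MeasurableSet F := measurableSet_closedBall
  have hFv : volume F ≠ ∞ := measure_closedBall_lt_top.ne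
  obtain ⟨ρ₀, hρ₀, hρ⟩ := exists_pos_setLIntegral_lt_of_measure_lt hKV
    (ε := ENNReal.ofReal (η / 2)) (by simpa using hη0)
  obtain ⟨ρ, hρ1, hρ2⟩ : ∃ ρ : ℝ, 0 < ρ ∧ ENNReal.ofReal ρ ≤ ρ₀ := by
    refine ⟨(min ρ₀ 1).toReal, ENNReal.toReal_pos (lt_min hρ₀ one_pos).ne'
      ((min_le_right _ _).trans_lt ENNReal.one_lt_top).ne, ?_⟩
    rw [ENNReal.ofReal_toReal ((min_le_right _ _).trans_lt ENNReal.one_lt_top).ne]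
    exact min_le_left _ _
  -- The L^r(K) norm of the constant 1 on F, finite by local integrability of K. The choice of d
  -- below makes κ d ≤ ε/2.
  set κ : ℝ := ((weighted K F) ^ (ENNReal.ofReal r).toReal⁻¹).toReal with hκ
  have hκ' : (weighted K F) ^ (ENNReal.ofReal r).toReal⁻¹ = ENNReal.ofReal κ :=
    (ENNReal.ofReal_toReal (ENNReal.rpow_ne_top_of_nonneg (by positivity) (hK j).ne)).symm
  have hκ0 : 0 ≤ κ := ENNReal.toReal_nonneg
  set d : ℝ := ε / 2 / (κ + 1) with hd
  have hd0 : 0 < d := by positivity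
  obtain ⟨h, hh, hstep⟩ := exists_volume_inter_le hs hp hFv (l := d / 3) (ρ := ρ / 4)
    (by positivity) (by positivity)
  obtain ⟨M, hM⟩ := exists_volume_nearIndex_ge_lt hh hFv (ε := ENNReal.ofReal (ρ / 4))
    (by simpa using hρ1)
  refine ⟨h, hh, M, d / 3, by positivity, fun u v hu hv hu1 hv1 huv => ?_⟩
  have hwc : Continuous (u - v) := hu.sub hv
  have hw : eNormMV s q p V (u - v) ≤ ENNReal.ofReal 2 := by
    have h1 := eNormMV_add_le s (q := q) (V := V) hp (hr.trans hrq.le) hu (hv.const_smul (-1 : ℝ))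
    rw [eNormMV_smul, neg_one_smul, ← sub_eq_add_neg] at h1
    refine h1.trans ?_
    rw [enorm_neg, enorm_one, one_mul]
    refine (add_le_add hu1 hv1).trans (le_of_eq ?_)
    norm_num
  set A : Set (EuclideanSpace ℝ (Fin n)) := F ∩ {x | d < |(u - v) x|} with hA
  have hAm : MeasurableSet A :=
    hFm.inter (measurableSet_lt measurable_const hwc.abs.measurable)
  have hAv : volume A < ρ₀ := by
    -- Off these three sets, u and v are each within d/3 of their averages, and the averages within
    -- d/3 of each other, so |u - v| ≤ d. Each set has measure at most ρ/4 in F.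
    have h1 : A ⊆ {x | d / 3 ≤ |u x - stepAvg hh u x|} ∪ {x | d / 3 ≤ |v x - stepAvg hh v x|} ∪
        {x | M ≤ nearIndex hh x} := by
      intro x hx
      by_contra! hcon
      simp only [Set.mem_union, Set.mem_ofPred_eq, not_or, not_le] at hcon
      obtain ⟨⟨h1, h2⟩, h3⟩ := hcon
      have h4 : |stepAvg hh u x - stepAvg hh v x| < d / 3 := huv _ h3
      have h5 : d < |u x - v x| := hx.2
      rw [abs_lt] at h1 h2 h4
      rw [lt_abs] at h5
      rcases h5 with h5 | h5 <;> linarith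
    have h2 : volume A = (volume.restrict F) A := by
      rw [Measure.restrict_apply hAm, Set.inter_eq_left.2 Set.inter_subset_left]
    rw [h2]
    calc (volume.restrict F) A ≤ _ := measure_mono h1
      _ ≤ ENNReal.ofReal (ρ / 4) + ENNReal.ofReal (ρ / 4) + ENNReal.ofReal (ρ / 4) :=
        (measure_union_le _ _).trans (add_le_add ((measure_union_le _ _).trans
          (add_le_add (hstep u hu (gagliardo_le_eNormMV.trans hu1))
            (hstep v hv (gagliardo_le_eNormMV.trans hv1)))) hM.le)
      _ < ENNReal.ofReal ρ := by
        rw [← ENNReal.ofReal_add (by positivity) (by positivity),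
          ← ENNReal.ofReal_add (by positivity) (by positivity),
          ENNReal.ofReal_lt_ofReal_iff hρ1]
        linarith
      _ ≤ ρ₀ := hρ2
  have hGA : ∫⁻ x in Fᶜ ∪ A, G x ≤ ENNReal.ofReal η := by
    refine (lintegral_union_le _ _ _).trans ((add_le_add hj.le (hρ A hAv).le).trans (le_of_eq ?_))
    rw [← ENNReal.ofReal_add (by positivity) (by positivity), add_halves]
  -- On the tail and the exceptional set, the weighted embedding gives smallness; on the complement,
  -- |u - v| ≤ d does.
  have h1 : eLpNorm (u - v) (ENNReal.ofReal r) ((weighted K).restrict (Fᶜ ∪ A)) ≤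
      ENNReal.ofReal (ε / 2) := by
    refine (H (u - v) hwc 2 two_pos hw (Fᶜ ∪ A) (hFm.compl.union hAm)).trans ?_
    have h2 : (∫⁻ x in Fᶜ ∪ A, G x) ^ a ≤ ENNReal.ofReal (ε / 2 / (C * 2)) := by
      refine (ENNReal.rpow_le_rpow hGA ha0.le).trans (le_of_eq ?_)
      rw [ENNReal.ofReal_rpow_of_nonneg hη0.le ha0.le, hη, ← Real.rpow_mul (by positivity),
        inv_mul_cancel₀ ha0.ne', Real.rpow_one]
    calc _ ≤ ENNReal.ofReal (C * 2) * ENNReal.ofReal (ε / 2 / (C * 2)) := by gcongr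
      _ = _ := by
        rw [← ENNReal.ofReal_mul (by positivity), mul_div_cancel₀ _ (by positivity)]
  have h2 : eLpNorm (u - v) (ENNReal.ofReal r) ((weighted K).restrict (Fᶜ ∪ A)ᶜ) ≤
      ENNReal.ofReal (ε / 2) := by
    have h3 : ∀ᵐ x ∂(weighted K).restrict (Fᶜ ∪ A)ᶜ, ‖(u - v) x‖ ≤ d := by
      filter_upwards [ae_restrict_mem (hFm.compl.union hAm).compl] with x hx
      by_contra! hcon
      by_cases hxF : x ∈ F
      · exact hx (Or.inr ⟨hxF, hcon⟩)
      · exact hx (Or.inl hxF)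
    refine (eLpNorm_le_of_ae_bound h3).trans ?_
    rw [Measure.restrict_apply_univ]
    have h4 : (weighted K (Fᶜ ∪ A)ᶜ) ^ (ENNReal.ofReal r).toReal⁻¹ ≤ ENNReal.ofReal κ := by
      rw [← hκ']
      gcongr
      intro x hx
      by_contra hxF
      exact hx (Or.inl hxF)
    calc _ ≤ ENNReal.ofReal κ * ENNReal.ofReal d := by gcongr
      _ ≤ _ := by
        rw [← ENNReal.ofReal_mul hκ0, hd]
        refine ENNReal.ofReal_le_ofReal ?_
        rw [mul_div_assoc', div_le_iff₀ (by positivity)]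
        nlinarith
  refine (eLpNorm_le_add_compl _ hwc.aestronglyMeasurable (ENNReal.one_le_ofReal.2 hr)
    (hFm.compl.union hAm)).trans ((add_le_add h1 h2).trans (le_of_eq ?_))
  rw [← ENNReal.ofReal_add (by positivity) (by positivity), add_halves]

end Compactness

end WeightedFractionalSobolev

/-! ### The operator on the completion: boundedness, compactness, injectivity -/

namespace WeightedFractionalSobolev

open Metric Filter Topology

section Operator

variable {n : ℕ} {s q : ℝ} {p : ℝ≥0∞} {V : EuclideanSpace ℝ (Fin n) → ℝ}

theorem weighted_absolutelyContinuous (W : EuclideanSpace ℝ (Fin n) → ℝ) : weighted W ≪ volume :=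
  withDensity_absolutelyContinuous _ _

theorem absolutelyContinuous_weighted {W : EuclideanSpace ℝ (Fin n) → ℝ}
    (hW : AEMeasurable W volume) (hW0 : ∀ x, 0 < W x) : volume ≪ weighted W :=
  withDensity_absolutelyContinuous' hW.ennreal_ofReal
    (ae_of_all _ fun x => by simpa using hW0 x)

/-- Fatou, applied separately to the L^q(V) norm and to the seminorm; each part is at most ε. -/
theorem eNormMV_le_of_tendsto_ae {u : EuclideanSpace ℝ (Fin n) → ℝ} (hu : Continuous u)
    {w : ℕ → EuclideanSpace ℝ (Fin n) → ℝ} (hw : ∀ i, Continuous (w i))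
    (hlim : ∀ᵐ x, Tendsto (fun i => w i x) atTop (𝓝 0)) {ε : ℝ≥0∞}
    (h : ∀ i, eNormMV s q p V (u - w i) ≤ ε) : eNormMV s q p V u ≤ ε + ε := by
  refine add_le_add ?_ ?_
  · refine (Lp.eLpNorm_lim_le_liminf_eLpNorm (f := fun i => u - w i)
      (fun i => (hu.sub (hw i)).aestronglyMeasurable) u ?_).trans
      (liminf_le_of_frequently_le' (Frequently.of_forall fun i => le_self_add.trans (h i)))
    filter_upwards [(weighted_absolutelyContinuous V).ae_le hlim] with x hx
    simpa using tendsto_const_nhds.sub hx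
  · refine (Lp.eLpNorm_lim_le_liminf_eLpNorm (f := fun i => diffQuot s p (u - w i))
      (fun i => aestronglyMeasurable_diffQuot s (hu.sub (hw i))) (diffQuot s p u) ?_).trans
      (liminf_le_of_frequently_le' (Frequently.of_forall fun i => le_add_self.trans (h i)))
    filter_upwards [Measure.quasiMeasurePreserving_fst.ae hlim,
      Measure.quasiMeasurePreserving_snd.ae hlim] with z h1 h2
    simp only [diffQuot, Pi.sub_apply]
    refine Tendsto.div_const ?_ _
    simpa using (tendsto_const_nhds.sub h1).sub (tendsto_const_nhds.sub h2)

theorem exists_abs_ballAvg_le (hq : 1 ≤ q) {V₀ : ℝ} (hV₀ : 0 < V₀) (hV : ∀ x, V₀ ≤ V x) {h : ℝ} (hh : 0 < h) :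
    ∃ R : ℝ, ∀ u : EuclideanSpace ℝ (Fin n) → ℝ, Continuous u → eNormMV s q p V u ≤ 1 →
      ∀ c, |ballAvg u c h| ≤ R := by
  have hω := unitBallVolume_pos n
  refine ⟨(h ^ n * unitBallVolume n) ^ (-((ENNReal.ofReal q)⁻¹).toReal) *
    V₀⁻¹ ^ (1 / ENNReal.ofReal q).toReal, fun u hu hu1 c => ?_⟩
  rw [← ENNReal.ofReal_le_ofReal_iff (by positivity), ← Real.enorm_eq_ofReal_abs,
    ENNReal.ofReal_mul (by positivity), ← inv_volume_ball_rpow c hh ENNReal.toReal_nonneg]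
  refine (enorm_ballAvg_le hu c hh (ENNReal.one_le_ofReal.2 hq)).trans ?_
  gcongr
  refine (eLpNorm_le_eLpNorm_weighted hV₀ hV _ ENNReal.ofReal_ne_top).trans
    ((mul_le_of_le_one_right' (le_self_add.trans hu1)).trans (le_of_eq ?_))
  rw [ENNReal.ofReal_rpow_of_nonneg (by positivity) ENNReal.toReal_nonneg]

variable [hq : Fact (1 ≤ q)] [hp : Fact (1 ≤ p)]

theorem TestSpace.continuous_toFun (u : TestSpace n s q p V) : Continuous u.toFun :=
  u.2.1.continuous

theorem TestSpace.eNormMV_eq (u : TestSpace n s q p V) :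
    eNormMV s q p V u.toFun = ENNReal.ofReal ‖u‖ :=
  (ENNReal.ofReal_toReal u.2.2.2.ne).symm

variable {r : ℝ} [hr : Fact (1 ≤ r)] {K : EuclideanSpace ℝ (Fin n) → ℝ}

/-- Continuous inclusions of the space of test functions into `L^r(K)`. -/
theorem exists_continuousLinearMap_of_eLpNorm_le {C : ℝ}
    (H : ∀ u : EuclideanSpace ℝ (Fin n) → ℝ, Continuous u →
      ∀ N : ℝ, 0 < N → eNormMV s q p V u ≤ ENNReal.ofReal N →
        eLpNorm u (ENNReal.ofReal r) (weighted K) ≤ ENNReal.ofReal (C * N)) :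
    ∃ T : TestSpace n s q p V →L[ℝ] LrK r K, ∀ u, T u =ᵐ[weighted K] u.toFun := by
  have hbound : ∀ (u : TestSpace n s q p V) (N : ℝ), ‖u‖ < N →
      eLpNorm u.toFun (ENNReal.ofReal r) (weighted K) ≤ ENNReal.ofReal (C * N) := fun u N hN =>
    H u.toFun u.continuous_toFun N ((norm_nonneg u).trans_lt hN)
      (u.eNormMV_eq.trans_le (ENNReal.ofReal_le_ofReal hN.le))
  have hmem : ∀ u : TestSpace n s q p V, MemLp u.toFun (ENNReal.ofReal r) (weighted K) :=
    fun u => ⟨u.continuous_toFun.aestronglyMeasurable,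
      (hbound u _ (lt_add_one _)).trans_lt ENNReal.ofReal_lt_top⟩
  let T : TestSpace n s q p V →ₗ[ℝ] LrK r K :=
    { toFun := fun u => (hmem u).toLp u.toFun
      map_add' := fun u v => MemLp.toLp_add (hmem u) (hmem v)
      map_smul' := fun c u => MemLp.toLp_const_smul c (hmem u) }
  refine ⟨T.mkContinuous (max C 0) fun u => ?_, fun u => (hmem u).coeFn_toLp⟩
  have h1 : ∀ N, ‖u‖ < N → ‖T u‖ ≤ max C 0 * N := fun N hN => by
    have hN0 : 0 < N := (norm_nonneg u).trans_lt hN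
    have h2 : ‖T u‖ = (eLpNorm u.toFun (ENNReal.ofReal r) (weighted K)).toReal :=
      Lp.norm_toLp _ (hmem u)
    rw [h2]
    refine ENNReal.toReal_le_of_le_ofReal (by positivity) ((hbound u N hN).trans ?_)
    gcongr
    exact le_max_left _ _
  -- The estimate needs N > 0, so N = ‖u‖ is reached only as a limit; this covers ‖u‖ = 0.
  refine ge_of_tendsto (x := 𝓝[>] ‖u‖) (f := fun N => max C 0 * N) ?_ ?_
  · exact ((continuous_const.mul continuous_id).tendsto _).mono_left nhdsWithin_le_nhds
  · filter_upwards [self_mem_nhdsWithin] with N hN using h1 N hN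

/-- The M averages are bounded uniformly over the unit ball. Sorting them into cells of width δ
leaves finitely many classes, and members of one class are ε-close in L^r(K). -/
theorem totallyBounded_image_closedBall {V₀ : ℝ} (hV₀ : 0 < V₀) (hV : ∀ x, V₀ ≤ V x)
    {T : TestSpace n s q p V →L[ℝ] LrK r K} (hT : ∀ u, T u =ᵐ[weighted K] u.toFun)
    (H : ∀ ε > 0, ∃ h > 0, ∃ M : ℕ, ∃ δ > 0, ∀ u v : EuclideanSpace ℝ (Fin n) → ℝ, Continuous u →
      Continuous v → eNormMV s q p V u ≤ 1 → eNormMV s q p V v ≤ 1 →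
      (∀ k < M, |ballAvg u (TopologicalSpace.denseSeq _ k) h -
        ballAvg v (TopologicalSpace.denseSeq _ k) h| < δ) →
      eLpNorm (u - v) (ENNReal.ofReal r) (weighted K) ≤ ENNReal.ofReal ε) :
    TotallyBounded (T '' closedBall 0 1) := by
  refine Metric.totallyBounded_of_finite_discretization fun ε hε => ?_
  obtain ⟨h, hh, M, δ, hδ, H⟩ := H (ε / 2) (by positivity)
  obtain ⟨R, hR⟩ := exists_abs_ballAvg_le (n := n) (s := s) (q := q) (p := p) hq.out hV₀ hV hh
  have hpre : ∀ y : T '' closedBall (0 : TestSpace n s q p V) 1, ∃ u : TestSpace n s q p V,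
      eNormMV s q p V u.toFun ≤ 1 ∧ T u = y := by
    rintro ⟨_, u, hu, rfl⟩
    refine ⟨u, ?_, rfl⟩
    rw [u.eNormMV_eq]
    exact ENNReal.ofReal_le_one.2 (mem_closedBall_zero_iff.1 hu)
  choose g hg1 hg2 using hpre
  have hfl : ∀ y k, ⌊ballAvg (g y).toFun (TopologicalSpace.denseSeq _ k) h / δ⌋ ∈
      Finset.Icc ⌊-R / δ⌋ ⌊R / δ⌋ := fun y k => by
    have h1 := abs_le.1 (hR (g y).toFun (g y).continuous_toFun (hg1 y)
      (TopologicalSpace.denseSeq _ k))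
    rw [Finset.mem_Icc]
    constructor
    · gcongr
      exact h1.1
    · gcongr
      exact h1.2
  refine ⟨Fin M → Finset.Icc ⌊-R / δ⌋ ⌊R / δ⌋, inferInstance, fun y k => ⟨_, hfl y k⟩,
    fun y z hyz => ?_⟩
  rw [← hg2 y, ← hg2 z, Lp.dist_def, eLpNorm_congr_ae ((hT (g y)).sub (hT (g z)))]
  have h1 := H _ _ (g y).continuous_toFun (g z).continuous_toFun (hg1 y) (hg1 z) fun k hk => by
    have h2 := congrArg Subtype.val (congrFun hyz ⟨k, hk⟩)
    have h3 := Int.abs_sub_lt_one_of_floor_eq_floor h2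
    rw [← sub_div, abs_div, abs_of_pos hδ, div_lt_one hδ] at h3
    exact h3
  exact (ENNReal.toReal_le_of_le_ofReal (by positivity) h1).trans_lt (by linarith)

/-- Test functions in the open unit ball are dense in the open unit ball of the completion, so its
image lies in the closure of a totally bounded set, compact as L^r(K) is complete. -/
theorem isCompactOperator_of_totallyBounded {T : TestSpace n s q p V →L[ℝ] LrK r K}
    {ι : MV n s q p V →L[ℝ] LrK r K} (hι : ∀ u : TestSpace n s q p V, ι (u : MV n s q p V) = T u)
    (hT : TotallyBounded (T '' closedBall 0 1)) : IsCompactOperator ι := by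
  refine ⟨closure (T '' closedBall 0 1), hT.closure.isCompact_of_isClosed isClosed_closure,
    mem_of_superset (ball_mem_nhds 0 one_pos) fun x hx => ?_⟩
  have h1 : x ∈ closure (ball 0 1 ∩ Set.range ((↑) : TestSpace n s q p V → MV n s q p V)) :=
    UniformSpace.Completion.denseRange_coe.open_subset_closure_inter isOpen_ball hx
  refine closure_mono ?_ (image_closure_subset_closure_image ι.continuous ⟨x, h1, rfl⟩)
  rintro _ ⟨_, ⟨h2, u, rfl⟩, rfl⟩
  refine ⟨u, ?_, (hι u).symm⟩
  rw [mem_ball_zero_iff, UniformSpace.Completion.norm_coe] at h2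
  exact mem_closedBall_zero_iff.2 h2.le

/-- If ι x = 0, test functions u_k → x have a subsequence tending to 0 a.e. Since (u_k) is Cauchy,
Fatou applied to u_k minus that subsequence shows ‖u_k‖ → 0. -/
theorem injective_of_coe_eq (hKm : AEMeasurable K volume) (hK0 : ∀ x, 0 < K x)
    {ι : MV n s q p V →L[ℝ] LrK r K}
    (hι : ∀ u : TestSpace n s q p V, ι (u : MV n s q p V) =ᵐ[weighted K] u.toFun) :
    Function.Injective ι := by
  refine (injective_iff_map_eq_zero ι).2 fun x hx => ?_
  obtain ⟨y, hy, hyx⟩ := mem_closure_iff_seq_limit.1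
    (UniformSpace.Completion.denseRange_coe (α := TestSpace n s q p V) x)
  choose u hu using hy
  obtain rfl : (fun k => (u k : MV n s q p V)) = y := funext hu
  have h0 : Tendsto (fun k => ι (u k : MV n s q p V)) atTop (𝓝 0) := by
    have := (ι.continuous.tendsto x).comp hyx
    rwa [hx] at this
  obtain ⟨ns, hns, hae⟩ := (tendstoInMeasure_of_tendsto_Lp h0).exists_seq_tendsto_ae
  have hae' : ∀ᵐ z ∂volume, Tendsto (fun i => (u (ns i)).toFun z) atTop (𝓝 0) := by
    refine (absolutelyContinuous_weighted hKm hK0).ae_le ?_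
    filter_upwards [hae, ae_all_iff.2 fun i => hι (u (ns i)),
      Lp.coeFn_zero ℝ (ENNReal.ofReal r) (weighted K)] with z h1 h2 h3
    rw [h3, Pi.zero_apply] at h1
    simpa only [h2] using h1
  refine norm_le_zero_iff.1 (le_of_forall_pos_le_add fun ε hε => ?_)
  rw [zero_add]
  obtain ⟨N, hN⟩ := Metric.cauchySeq_iff.1 hyx.cauchySeq (ε / 2) (by positivity)
  refine le_of_tendsto hyx.norm (eventually_atTop.2 ⟨N, fun k hk => ?_⟩)
  rw [UniformSpace.Completion.norm_coe]
  have h1 : eNormMV s q p V (u k).toFun ≤ ENNReal.ofReal (ε / 2) + ENNReal.ofReal (ε / 2) := by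
    refine eNormMV_le_of_tendsto_ae (u k).continuous_toFun
      -- The shift by N puts every term of the subsequence past the Cauchy threshold.
      (w := fun i => (u (ns (i + N))).toFun) (fun i => (u _).continuous_toFun) ?_ fun i => ?_
    · filter_upwards [hae'] with z hz using hz.comp (tendsto_add_atTop_nat N)
    · have h2 := hN k hk (ns (i + N)) ((Nat.le_add_left N i).trans (hns.id_le _))
      rw [UniformSpace.Completion.dist_eq, dist_eq_norm] at h2
      exact (u k - u (ns (i + N))).eNormMV_eq.trans_le (ENNReal.ofReal_le_ofReal h2.le)
  rw [TestSpace.eNormMV_eq, ← ENNReal.ofReal_add (by positivity) (by positivity), add_halves,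
    ENNReal.ofReal_le_ofReal_iff hε.le] at h1
  exact h1

end Operator

end WeightedFractionalSobolev

/-! ### The compact embedding -/

theorem theorem10 (n : ℕ) (hn : 2 ≤ n) (s : ℝ) (hs0 : 0 < s) (hs1 : s < 1)
    (p : ℝ≥0∞) [Fact (1 ≤ p)] (hsp : (n : ℝ≥0∞) ≤ ENNReal.ofReal s * p)
    (r q : ℝ) [Fact (1 ≤ r)] [Fact (1 ≤ q)] (hrq : r < q)
    (K V : EuclideanSpace ℝ (Fin n) → ℝ)
    (hKm : AEMeasurable K volume) (hVm : AEMeasurable V volume)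
    (hK0 : ∀ x, 0 < K x)
    (t : ℝ≥0∞) (ht : 1 < t)
    (hKt : ∀ D : Set (EuclideanSpace ℝ (Fin n)), IsCompact D → MemLp K t (volume.restrict D))
    (V₀ : ℝ) (hV₀ : 0 < V₀) (hV : ∀ x, V₀ ≤ V x)
    (q' : ℝ) (hq' : q < q') (τ : ℝ) (hτ0 : 0 < τ) (hτ1 : τ ≤ r / (q - r))
    (hKV : Integrable
      (fun x => K x ^ ((q' + τ * (q' - q)) / (q' - r)) * V x ^ (-τ)) volume) :
    ∃ ι : WeightedFractionalSobolev.MV n s q p V →L[ℝ] WeightedFractionalSobolev.LrK r K,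
      (∀ u : WeightedFractionalSobolev.TestSpace n s q p V,
        (ι (u : WeightedFractionalSobolev.MV n s q p V) : EuclideanSpace ℝ (Fin n) → ℝ)
          =ᵐ[volume] u.toFun) ∧
      Function.Injective ι ∧ IsCompactOperator ι := by
  open WeightedFractionalSobolev in
  have hn0 : n ≠ 0 := by omega
  have hp1 : 1 ≤ p := Fact.out
  have hr1 : 1 ≤ r := Fact.out
  have hKV' := hKV.lintegral_lt_top.ne
  obtain ⟨C, hC, H⟩ := exists_eLpNorm_weighted_restrict_le hn0 hs0 hp1 hsp hr1 hrq hq' hτ0 hτ1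
    hKm hVm hK0 hV₀ hV
  have he : 0 ≤ (q' - r) / (q' + τ * (q' - q)) / r := by
    have h1 : 0 < q' - r := by linarith
    have h2 : 0 < τ * (q' - q) := mul_pos hτ0 (by linarith)
    have h3 : 0 < q' + τ * (q' - q) := by linarith
    positivity
  obtain ⟨T, hT⟩ := exists_continuousLinearMap_of_eLpNorm_le (s := s) (q := q) (p := p) (V := V)
    (K := K) (r := r)
    -- Boundedness is the weighted embedding on the whole space; the finite total integral goes into
    -- the constant.
    (C := C * ((∫⁻ x, ENNReal.ofReal
      (K x ^ ((q' + τ * (q' - q)) / (q' - r)) * V x ^ (-τ))) ^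
        ((q' - r) / (q' + τ * (q' - q)) / r)).toReal)
    fun u hu N hN huN => by
      have h1 := H u hu N hN huN Set.univ MeasurableSet.univ
      rw [Measure.restrict_univ, Measure.restrict_univ] at h1
      rwa [mul_right_comm, ENNReal.ofReal_mul (by positivity),
        ENNReal.ofReal_toReal (ENNReal.rpow_ne_top_of_nonneg he hKV')]
  have htb := totallyBounded_image_closedBall hV₀ hV hT fun ε hε =>
    exists_eLpNorm_sub_le_of_ballAvg hn0 hs0 hp1 hsp hr1 hrq hq' hτ0 hτ1 hKm hVm hK0
      (fun R => weighted_lt_top_of_memLp ht.le measurableSet_closedBall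
        measure_closedBall_lt_top.ne (hKt _ (isCompact_closedBall 0 R))) hV₀ hV hKV' hε
  have hι : ∀ u : TestSpace n s q p V,
      T.extend (UniformSpace.Completion.toComplL (𝕜 := ℝ)) (u : MV n s q p V) = T u :=
    T.extend_eq UniformSpace.Completion.denseRange_coe
      (UniformSpace.Completion.isUniformInducing_coe _)
  have hι' : ∀ u : TestSpace n s q p V,
      T.extend (UniformSpace.Completion.toComplL (𝕜 := ℝ)) (u : MV n s q p V)
        =ᵐ[weighted K] u.toFun := fun u => by
    rw [hι u]
    exact hT u
  -- Since K > 0, sets null for K dx are Lebesgue null.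
  exact ⟨_, fun u => (absolutelyContinuous_weighted hKm hK0).ae_le (hι' u),
    injective_of_coe_eq hKm hK0 hι', isCompactOperator_of_totallyBounded hι htb⟩
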